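/- Let $d\ge 1$ and let $\Omega\subset\mathbb R^d$ be a bounded domain that coincides with the interior of its closure (for instance, a bounded domain with Lipschitz boundary). Let $\varepsilon>0$ be a constant, $\mathbf b\in W^{1,\infty}(\Omega)^d$ with $\nabla\cdot\mathbf b=0$, $c\in L^\infty(\Omega)$ with $c\ge\sigma_0\ge 0$ in $\Omega$ for a constant $\sigma_0$, and $g\in L^2(\Omega)$. Let $(\cdot,\cdot)$ be the inner product of $L^2(\Omega)$ or $L^2(\Omega)^d$. Let $\mathcal T_h$ be a (finite, conforming) simplicial triangulation of $\overline\Omega$ with vertices $x_1,\dots,x_N$, where $x_1,\dots,x_M\in\Omega$ and $x_{M+1},\dots,x_N\in\partial\Omega$, and let $\varphi_1,\dots,\varphi_N$ be the continuous functions on $\overline\Omega$ that are affine on every simplex of $\mathcal T_h$ and satisfy $\varphi_i(x_j)=\delta_{ij}$. Set $a_{ij}=a_h(\varphi_j,\varphi_i)$ and $g_i=(g,\varphi_i)$, where $a_h$ is one of the bilinear forms $$a_h(u,v)=\varepsilon(\nabla u,\nabla v)+(\mathbf b\cdot\nabla u,v)+(c\,u,v),$$ $$a_h(u,v)=\varepsilon(\nabla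 u,\nabla v)+(\mathbf b\cdot\nabla u,v)+\sum_{i=1}^M(c,\varphi_i)\,u(x_i)\,v(x_i).$$ For $i=1,\dots,M$ let $$S_i=\{j\in\{1,\dots,N\}\setminus\{i\}\,;\ x_i\text{ and }x_j\text{ are end points of the same edge of }\mathcal T_h\}.$$ For every $U=(u_1,\dots,u_N)\in\mathbb R^N$ let $\mathbb B(U)=(b_{ij}(U))_{i,j=1}^N$ be a real matrix such that for all $U$: $b_{ij}(U)=b_{ji}(U)$ for all $i,j$; $b_{ij}(U)\le 0$ for $i\ne j$; $\sum_{j=1}^N b_{ij}(U)=0$ for all $i$; and $b_{ij}(U)=0$ for $i=1,\dots,M$ and $j\notin S_i\cup\{i\}$. Assume moreover: (A1) for $i\in\{1,\dots,M\}$ and $j\in\{1,\dots,N\}$ the function $U\mapsto b_{ij}(U)(u_j-u_i)$ is continuous on $\mathbb R^N$, and for $i\in\{1,\dots,M\}$ and $j\in\{M+1,\dots,N\}$ the function $U\mapsto b_{ij}(U)$ is bounded on $\mathbb R^N$; (A2) for $U\in\mathbb R^N$ and $i\in\{1,\dots,M\}$, if $u_i>u_j$ for all $j\in S_i$, or $u_i<u_j$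 for all $j\in S_i$, then $a_{ij}+b_{ij}(U)\le 0$ for all $j\in S_i$. Let $\mathscr G_h\subset\mathcal T_h$ be a nonempty set of mesh simplices and $G_h=\bigcup_{T\in\mathscr G_h}T$, with boundary $\partial G_h$ in $\mathbb R^d$. Let $U\in\mathbb R^N$ satisfy $$\sum_{j=1}^N\bigl(a_{ij}+b_{ij}(U)\bigr)u_j=g_i,\qquad i=1,\dots,M,$$ and let $u_h=\sum_{i=1}^N u_i\varphi_i$. Write $u^+=\max\{u,0\}$, $u^-=\min\{u,0\}$; conditions on $g$ and $c$ in $G_h$ are understood almost everywhere. Then $$g\le 0\ \text{in }G_h\ \Rightarrow\ \max_{G_h}u_h\le\max_{\partial G_h}u_h^+,\qquad g\ge 0\ \text{in }G_h\ \Rightarrow\ \min_{G_h}u_h\ge\min_{\partial G_h}u_h^-.$$ If, in addition, $c=0$ in $G_h$, then $$g\le 0\ \text{in }G_h\ \Rightarrow\ \max_{G_h}u_h=\max_{\partial G_h}u_h,\qquad g\ge 0\ \text{in }G_h\ \Rightarrow\ \min_{G_h}u_h=\min_{\partial G_h}u_h.$$ -/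

import Mathlib

open MeasureTheory Geometry
open scoped ContDiff

noncomputable section

/-! ### Function spaces for the data -/

/-- `f'` is the weak partial derivative of `f` in `Ω` in the `k`-th coordinate direction. -/
def HasWeakPartialDeriv {d : ℕ} (Ω : Set (EuclideanSpace ℝ (Fin d))) (k : Fin d)
    (f f' : EuclideanSpace ℝ (Fin d) → ℝ) : Prop :=
  ∀ ψ : EuclideanSpace ℝ (Fin d) → ℝ, ContDiff ℝ ∞ ψ → HasCompactSupport ψ → tsupport ψ ⊆ Ω →
    ∫ x in Ω, f x * fderiv ℝ ψ x (EuclideanSpace.single k 1) = -∫ x in Ω, f' x * ψ x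

/-- Membership in the Sobolev space `W^{1,∞}(Ω)`. -/
def MemW1Infty {d : ℕ} (Ω : Set (EuclideanSpace ℝ (Fin d)))
    (f : EuclideanSpace ℝ (Fin d) → ℝ) : Prop :=
  MemLp f ⊤ (volume.restrict Ω) ∧
    ∀ k : Fin d, ∃ f' : EuclideanSpace ℝ (Fin d) → ℝ,
      MemLp f' ⊤ (volume.restrict Ω) ∧ HasWeakPartialDeriv Ω k f f'

/-- The vector field `b` is divergence free in `Ω`, in the weak sense. -/
def IsWeaklyDivFree {d : ℕ} (Ω : Set (EuclideanSpace ℝ (Fin d)))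
    (b : EuclideanSpace ℝ (Fin d) → EuclideanSpace ℝ (Fin d)) : Prop :=
  ∀ ψ : EuclideanSpace ℝ (Fin d) → ℝ, ContDiff ℝ ∞ ψ → HasCompactSupport ψ → tsupport ψ ⊆ Ω →
    ∫ x in Ω, inner ℝ (b x) (gradient ψ x) = 0

/-! ### Simplicial triangulations and continuous piecewise linear functions -/

/-- The geometric simplicial complex `K` is a (conforming, finite) triangulation of the closure
of `Ω ⊆ ℝ^d`; its mesh cells, the maximal simplices, are all `d`-dimensional. -/
structure IsTriangulation {d : ℕ} (K : SimplicialComplex ℝ (EuclideanSpace ℝ (Fin d)))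
    (Ω : Set (EuclideanSpace ℝ (Fin d))) : Prop where
  finite : K.faces.Finite
  space_eq : K.space = closure Ω
  card_facet : ∀ T ∈ K.facets, T.card = d + 1

/-- `w` is the family of barycentric coordinates of the point `p` with respect to the vertices of
some simplex of `K` that contains `p` (extended by zero to all other points). -/
def IsBarycentric {d : ℕ} (K : SimplicialComplex ℝ (EuclideanSpace ℝ (Fin d)))
    (p : EuclideanSpace ℝ (Fin d)) (w : EuclideanSpace ℝ (Fin d) → ℝ) : Prop :=
  ∃ T ∈ K.faces, (∀ v, 0 ≤ w v) ∧ (∀ v, v ∉ T → w v = 0) ∧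
    ∑ v ∈ T, w v = 1 ∧ ∑ v ∈ T, w v • v = p

/-- Barycentric coordinates do not depend on the simplex that is used to compute them. -/
theorem IsBarycentric.unique {d : ℕ} {K : SimplicialComplex ℝ (EuclideanSpace ℝ (Fin d))}
    {p : EuclideanSpace ℝ (Fin d)} {w w' : EuclideanSpace ℝ (Fin d) → ℝ}
    (h : IsBarycentric K p w) (h' : IsBarycentric K p w') : w = w' := by
  classical
  obtain ⟨s, hs, h0, hns, h1, hp⟩ := h
  obtain ⟨t, ht, h0', hnt, h1', hp'⟩ := h'
  have hps : p ∈ convexHull ℝ (s : Set (EuclideanSpace ℝ (Fin d))) :=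
    Finset.mem_convexHull'.2 ⟨w, fun y _ => h0 y, h1, hp⟩
  have hpt : p ∈ convexHull ℝ (t : Set (EuclideanSpace ℝ (Fin d))) :=
    Finset.mem_convexHull'.2 ⟨w', fun y _ => h0' y, h1', hp'⟩
  have hst := K.inter_subset_convexHull hs ht ⟨hps, hpt⟩
  rw [← Finset.coe_inter, Finset.mem_convexHull'] at hst
  obtain ⟨z, -, hz1, hzp⟩ := hst
  have key : ∀ (r : Finset (EuclideanSpace ℝ (Fin d))) (y : EuclideanSpace ℝ (Fin d) → ℝ),
      r ∈ K.faces → s ∩ t ⊆ r → (∀ v, v ∉ r → y v = 0) → ∑ v ∈ r, y v = 1 →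
      ∑ v ∈ r, y v • v = p → ∀ v, y v = if v ∈ s ∩ t then z v else 0 := by
    intro r y hr hsub hy0 hy1 hyp v
    by_cases hv : v ∈ r
    · refine (K.indep hr).eq_of_sum_eq_sum_subtype (w₁ := y)
        (w₂ := fun v => if v ∈ s ∩ t then z v else 0) ?_ ?_ v hv
      · rw [hy1, Finset.sum_ite_mem, Finset.inter_eq_right.2 hsub, hz1]
      · simp only [ite_smul, zero_smul]
        rw [hyp, Finset.sum_ite_mem, Finset.inter_eq_right.2 hsub, hzp]
    · rw [hy0 v hv, if_neg fun hm => hv (hsub hm)]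
  funext v
  rw [key s w hs Finset.inter_subset_left hns h1 hp v,
    key t w' ht Finset.inter_subset_right hnt h1' hp' v]

open Classical in
/-- The usual nodal basis function (hat function) of the vertex `v`: the continuous function on
the space of `K`, affine on each simplex, that is `1` at `v` and `0` at every other vertex. Its
value at `p` is the barycentric coordinate of `p` at `v`. (It is set to `0` off the space of `K`.) -/
def hatFunction {d : ℕ} (K : SimplicialComplex ℝ (EuclideanSpace ℝ (Fin d)))
    (v p : EuclideanSpace ℝ (Fin d)) : ℝ :=
  if h : ∃ w, IsBarycentric K p w then h.choose v else 0

/-- The finite element function with coefficients `U` at the vertices `x i`. -/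
def feFunction {d N : ℕ} (K : SimplicialComplex ℝ (EuclideanSpace ℝ (Fin d)))
    (x : Fin N → EuclideanSpace ℝ (Fin d)) (U : Fin N → ℝ) (p : EuclideanSpace ℝ (Fin d)) : ℝ :=
  ∑ i, U i * hatFunction K (x i) p

/-- The indices `j ≠ i` such that `x i` and `x j` are the end points of an edge of `K`. -/
def edgeNeighbours {d N : ℕ} (K : SimplicialComplex ℝ (EuclideanSpace ℝ (Fin d)))
    (x : Fin N → EuclideanSpace ℝ (Fin d)) (i : Fin N) : Set (Fin N) :=
  {j | j ≠ i ∧ ∃ e ∈ K.faces, (e : Set (EuclideanSpace ℝ (Fin d))) = {x i, x j}}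

/-- The union of the closed simplices of a collection. -/
def simplexUnion {d : ℕ} (𝒢 : Set (Finset (EuclideanSpace ℝ (Fin d)))) :
    Set (EuclideanSpace ℝ (Fin d)) :=
  ⋃ T ∈ 𝒢, convexHull ℝ (T : Set (EuclideanSpace ℝ (Fin d)))

/-! ### The bilinear forms

The gradients of piecewise linear functions exist classically almost everywhere. -/

/-- `ε (∇u, ∇v) + (b · ∇u, v)`, with `L²(Ω)` inner products. -/
def convDiffForm {d : ℕ} (Ω : Set (EuclideanSpace ℝ (Fin d))) (ε : ℝ)
    (b : EuclideanSpace ℝ (Fin d) → EuclideanSpace ℝ (Fin d))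
    (u v : EuclideanSpace ℝ (Fin d) → ℝ) : ℝ :=
  ε * (∫ p in Ω, inner ℝ (gradient u p) (gradient v p)) +
    ∫ p in Ω, inner ℝ (b p) (gradient u p) * v p

/-- `a(u, v) = ε (∇u, ∇v) + (b · ∇u, v) + (c u, v)`. -/
def galerkinForm {d : ℕ} (Ω : Set (EuclideanSpace ℝ (Fin d))) (ε : ℝ)
    (b : EuclideanSpace ℝ (Fin d) → EuclideanSpace ℝ (Fin d))
    (c : EuclideanSpace ℝ (Fin d) → ℝ) (u v : EuclideanSpace ℝ (Fin d) → ℝ) : ℝ :=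
  convDiffForm Ω ε b u v + ∫ p in Ω, c p * u p * v p

/-- The form with lumped reaction term,
`ε (∇u, ∇v) + (b · ∇u, v) + ∑ (c, φ_i) u(x_i) v(x_i)`, the sum being over the first `M` vertices
(the interior ones). -/
def lumpedForm {d N : ℕ} (Ω : Set (EuclideanSpace ℝ (Fin d))) (ε : ℝ)
    (b : EuclideanSpace ℝ (Fin d) → EuclideanSpace ℝ (Fin d))
    (c : EuclideanSpace ℝ (Fin d) → ℝ) (K : SimplicialComplex ℝ (EuclideanSpace ℝ (Fin d)))
    (x : Fin N → EuclideanSpace ℝ (Fin d)) (M : ℕ) (u v : EuclideanSpace ℝ (Fin d) → ℝ) : ℝ :=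
  convDiffForm Ω ε b u v +
    ∑ i : Fin N with i.val < M, (∫ p in Ω, c p * hatFunction K (x i) p) * u (x i) * v (x i)

/-- The matrix `a_ij = a_h(φ_j, φ_i)`. -/
def femMatrix {d N : ℕ} (K : SimplicialComplex ℝ (EuclideanSpace ℝ (Fin d)))
    (x : Fin N → EuclideanSpace ℝ (Fin d))
    (a_h : (EuclideanSpace ℝ (Fin d) → ℝ) → (EuclideanSpace ℝ (Fin d) → ℝ) → ℝ) :
    Matrix (Fin N) (Fin N) ℝ :=
  Matrix.of fun i j => a_h (hatFunction K (x j)) (hatFunction K (x i))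

/-- The right-hand side `g_i = (g, φ_i)`. -/
def femLoad {d N : ℕ} (Ω : Set (EuclideanSpace ℝ (Fin d)))
    (K : SimplicialComplex ℝ (EuclideanSpace ℝ (Fin d)))
    (x : Fin N → EuclideanSpace ℝ (Fin d)) (g : EuclideanSpace ℝ (Fin d) → ℝ) (i : Fin N) : ℝ :=
  ∫ p in Ω, g p * hatFunction K (x i) p

/-! ### The solution-dependent artificial diffusion matrix

Indices `i` with `i.val < M` stand for the interior vertices `1, …, M`. -/

/-- The structural assumptions on the artificial diffusion matrix `B(U)`: symmetric, nonpositive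
off-diagonal entries, zero row sums, and vanishing outside the neighbourhoods `S i`. -/
structure IsArtificialDiffusion {N : ℕ} (M : ℕ) (S : Fin N → Set (Fin N))
    (B : (Fin N → ℝ) → Matrix (Fin N) (Fin N) ℝ) : Prop where
  symm : ∀ U i j, B U i j = B U j i
  nonpos : ∀ U i j, i ≠ j → B U i j ≤ 0
  row_sum : ∀ U i, ∑ j, B U i j = 0
  local_support : ∀ U (i j : Fin N), i.val < M → j ∉ S i → j ≠ i → B U i j = 0

/-- Assumption (A1): `b_ij(U) (u_j - u_i)` is continuous in `U` for `i` interior, and `b_ij(U)` is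
bounded for `i` interior and `j` on the boundary. -/
structure AssumptionA1 {N : ℕ} (M : ℕ)
    (B : (Fin N → ℝ) → Matrix (Fin N) (Fin N) ℝ) : Prop where
  continuous : ∀ i j : Fin N, i.val < M → Continuous fun U : Fin N → ℝ => B U i j * (U j - U i)
  bounded : ∀ i j : Fin N, i.val < M → M ≤ j.val → ∃ C : ℝ, ∀ U, |B U i j| ≤ C

/-- Assumption (A2), for the matrix `A = (a_ij)`: in a row where `u_i` is a strict local extremum
with respect to `S i`, one has `a_ij + b_ij(U) ≤ 0` for all `j ∈ S i`. -/
def AssumptionA2 {N : ℕ} (M : ℕ) (S : Fin N → Set (Fin N)) (A : Matrix (Fin N) (Fin N) ℝ)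
    (B : (Fin N → ℝ) → Matrix (Fin N) (Fin N) ℝ) : Prop :=
  ∀ (U : Fin N → ℝ) (i : Fin N), i.val < M →
    ((∀ j ∈ S i, U j < U i) ∨ (∀ j ∈ S i, U i < U j)) → ∀ j ∈ S i, A i j + B U i j ≤ 0

/-- `U` solves the nonlinear algebraic equations `∑_j (a_ij + b_ij(U)) u_j = g_i`, `i = 1, …, M`. -/
def SolvesStabilized {N : ℕ} (M : ℕ) (A : Matrix (Fin N) (Fin N) ℝ)
    (B : (Fin N → ℝ) → Matrix (Fin N) (Fin N) ℝ) (G : Fin N → ℝ) (U : Fin N → ℝ) : Prop :=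
  ∀ i : Fin N, i.val < M → ∑ j, (A i j + B U i j) * U j = G i

end

/-! ### Hat functions as barycentric coordinates, and the cells around a vertex -/

section HatFunctions

variable {d : ℕ} {K : SimplicialComplex ℝ (EuclideanSpace ℝ (Fin d))}
  {Ω : Set (EuclideanSpace ℝ (Fin d))}
  {T F : Finset (EuclideanSpace ℝ (Fin d))} {v p q : EuclideanSpace ℝ (Fin d)}
  {w : EuclideanSpace ℝ (Fin d) → ℝ}

/-! Suppose the maximum `s` of `u_h` over `G_h` exceeds its maximum over the boundary of `G_h`, and
let `J` index the vertices of `G_h` where `s` is attained. A piecewise affine function attains its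
maximum at a vertex, so `J` is nonempty. Its vertices are interior to `G_h`, hence lie in `Ω`, and
all their neighbours lie in `G_h`. In interior rows `A = (a_ij)` has row sums `r_i = (c, φ_i) ≥ 0`,
while `B` has row sums zero, so for `i ∈ J` the equation reads `∑_j (a_ij + b_ij)(u_j - s) + r_i s =
g_i ≤ 0`.

Every summand is nonnegative: (A2) gives this at strict maxima, and continuity from (A1) carries it
over to weak ones (`add_mul_sub_nonneg_of_local_max`). If `s > 0`, or if `c` vanishes on `G_h`, then
`r_i = 0` on `J`, all summands vanish, and `a_ij + b_ij = 0` for `i ∈ J`, `j ∉ J`. Summing over `J ×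
J` yields `∑∑ a_ij = -∑∑ b_ij ≤ 0` (`not_maximum_on_interior_indices`).

On the other hand, for `u = ∑_{i ∈ J} φ_i` that double sum is at least `ε‖∇u‖² + (b·∇u, u)`, and
this is positive (`sum_sum_convDiffForm_pos`). The convection term vanishes because `b` is
divergence free and `u` is zero outside `Ω`; the gradient term is positive because a zero gradient
would force the continuous function `u` to take only the values 0 and 1. Minima follow from the
symmetry `U ↦ -U`. -/

theorem IsBarycentric.hatFunction_eq (h : IsBarycentric K p w) : hatFunction K v p = w v := by
  have h' : ∃ w, IsBarycentric K p w := ⟨w, h⟩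
  rw [hatFunction, dif_pos h']
  exact congrFun (h'.choose_spec.unique h) v

theorem exists_isBarycentric
    (hp : p ∈ convexHull ℝ (T : Set (EuclideanSpace ℝ (Fin d)))) :
    ∃ w : EuclideanSpace ℝ (Fin d) → ℝ,
      (∀ u, 0 ≤ w u) ∧ (∀ u, u ∉ T → w u = 0) ∧ ∑ u ∈ T, w u = 1 ∧ ∑ u ∈ T, w u • u = p := by
  classical
  obtain ⟨w, h0, h1, hp⟩ := Finset.mem_convexHull'.1 hp
  refine ⟨fun u => if u ∈ T then w u else 0, fun u => ?_, fun u hu => by simp [hu], ?_, ?_⟩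
  · dsimp only
    split_ifs with hu
    exacts [h0 u hu, le_rfl]
  · rw [Finset.sum_congr rfl fun u hu => if_pos hu, h1]
  · rw [← hp]
    exact Finset.sum_congr rfl fun u hu => by simp [hu]

/-- The values of the hat functions at a point of a simplex are its barycentric coordinates. -/
theorem hatFunction_spec (hT : T ∈ K.faces)
    (hp : p ∈ convexHull ℝ (T : Set (EuclideanSpace ℝ (Fin d)))) :
    (∀ u, 0 ≤ hatFunction K u p) ∧ (∀ u, u ∉ T → hatFunction K u p = 0) ∧
      ∑ u ∈ T, hatFunction K u p = 1 ∧ ∑ u ∈ T, hatFunction K u p • u = p := by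
  obtain ⟨w, h⟩ := exists_isBarycentric hp
  have hw : ∀ u, hatFunction K u p = w u := fun u =>
    IsBarycentric.hatFunction_eq ⟨T, hT, h⟩
  simpa only [hw] using h

theorem hatFunction_of_notMem_space (hp : p ∉ K.space) : hatFunction K v p = 0 := by
  rw [hatFunction, dif_neg]
  rintro ⟨w, T, hT, h0, -, h1, hs⟩
  exact hp (SimplicialComplex.mem_space_iff.2
    ⟨T, hT, Finset.mem_convexHull'.2 ⟨w, fun y _ => h0 y, h1, hs⟩⟩)

theorem hatFunction_nonneg : 0 ≤ hatFunction K v p := by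
  by_cases hp : p ∈ K.space
  · obtain ⟨T, hT, hpT⟩ := SimplicialComplex.mem_space_iff.1 hp
    exact (hatFunction_spec hT hpT).1 v
  · rw [hatFunction_of_notMem_space hp]

theorem hatFunction_le_one : hatFunction K v p ≤ 1 := by
  by_cases hp : p ∈ K.space
  · obtain ⟨T, hT, hpT⟩ := SimplicialComplex.mem_space_iff.1 hp
    obtain ⟨h0, hn, h1, -⟩ := hatFunction_spec hT hpT
    by_cases hv : v ∈ T
    · rw [← h1]
      exact Finset.single_le_sum (f := fun u => hatFunction K u p) (fun u _ => h0 u) hv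
    · rw [hn v hv]
      exact zero_le_one
  · rw [hatFunction_of_notMem_space hp]
    exact zero_le_one

theorem hatFunction_vertex [DecidableEq (EuclideanSpace ℝ (Fin d))] (hp : p ∈ K.vertices) :
    hatFunction K v p = if v = p then 1 else 0 := by
  obtain ⟨-, hn, h1, -⟩ := hatFunction_spec (K := K) (T := {p}) hp
    (p := p) (subset_convexHull ℝ _ (by simp))
  split_ifs with h
  · simpa [h] using h1
  · exact hn v (by simpa using h)

theorem sum_hatFunction {N : ℕ} {x : Fin N → EuclideanSpace ℝ (Fin d)}
    (hx_inj : Function.Injective x) (hx_range : Set.range x = K.vertices) (hT : T ∈ K.faces)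
    (hp : p ∈ convexHull ℝ (T : Set (EuclideanSpace ℝ (Fin d)))) (f : Fin N → ℝ) :
    ∃ I : Finset (Fin N), (∀ i, i ∈ I ↔ x i ∈ T) ∧
      ∑ i, f i * hatFunction K (x i) p = ∑ i ∈ I, f i * hatFunction K (x i) p ∧
      ∑ i ∈ I, hatFunction K (x i) p = 1 := by
  classical
  obtain ⟨-, hn, h1, -⟩ := hatFunction_spec hT hp
  refine ⟨Finset.univ.filter fun i => x i ∈ T, fun i => by simp, ?_, ?_⟩
  · refine (Finset.sum_subset (Finset.subset_univ _) fun i _ hi => ?_).symm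
    rw [hn (x i) (by simpa using hi), mul_zero]
  · rw [← h1]
    refine Finset.sum_bij (fun i _ => x i) (fun i hi => by simpa using hi)
      (fun i _ j _ h => hx_inj h) (fun u hu => ?_) (fun i _ => rfl)
    have : u ∈ Set.range x := by
      rw [hx_range]
      exact K.down_closed hT (by simpa using hu) (Finset.singleton_nonempty u)
    obtain ⟨i, rfl⟩ := this
    exact ⟨i, by simpa using hu, rfl⟩

theorem sum_hatFunction_eq_one {N : ℕ} {x : Fin N → EuclideanSpace ℝ (Fin d)}
    (hx_inj : Function.Injective x) (hx_range : Set.range x = K.vertices) (hp : p ∈ K.space) :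
    ∑ i, hatFunction K (x i) p = 1 := by
  obtain ⟨T, hT, hpT⟩ := SimplicialComplex.mem_space_iff.1 hp
  obtain ⟨I, -, h, h1⟩ := sum_hatFunction hx_inj hx_range hT hpT (fun _ => 1)
  simpa [h1] using h

theorem exists_facet_of_mem_faces (hfin : K.faces.Finite) (hF : F ∈ K.faces) :
    ∃ T ∈ K.facets, F ⊆ T := by
  obtain ⟨T, hFT, hT⟩ := hfin.exists_le_maximal hF
  exact ⟨T, ⟨hT.prop, fun t ht h => le_antisymm h (hT.le_of_ge ht h)⟩, hFT⟩

theorem exists_facet_of_mem_space (hfin : K.faces.Finite) (hp : p ∈ K.space) :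
    ∃ T ∈ K.facets, p ∈ convexHull ℝ (T : Set (EuclideanSpace ℝ (Fin d))) := by
  obtain ⟨F, hF, hpF⟩ := SimplicialComplex.mem_space_iff.1 hp
  obtain ⟨T, hT, hFT⟩ := exists_facet_of_mem_faces hfin hF
  exact ⟨T, hT, convexHull_mono (by exact_mod_cast hFT) hpF⟩

theorem isCompact_convexHull_finset :
    IsCompact (convexHull ℝ (T : Set (EuclideanSpace ℝ (Fin d)))) :=
  T.finite_toSet.isCompact_convexHull ℝ

theorem mem_of_hatFunction_ne_zero (hT : T ∈ K.faces)
    (hp : p ∈ convexHull ℝ (T : Set (EuclideanSpace ℝ (Fin d)))) (h : hatFunction K v p ≠ 0) :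
    v ∈ T := by
  by_contra hv
  exact h ((hatFunction_spec hT hp).2.1 v hv)

/-- The vertices of a full-dimensional simplex as an affine basis. -/
theorem exists_affineBasis (hT : T ∈ K.faces) (hcard : T.card = d + 1) :
    ∃ β : AffineBasis T ℝ (EuclideanSpace ℝ (Fin d)), ∀ u, β u = u := by
  have h := K.indep hT
  have hspan : affineSpan ℝ (Set.range ((↑) : T → EuclideanSpace ℝ (Fin d))) = ⊤ :=
    h.affineSpan_eq_top_iff_card_eq_finrank_add_one.2 (by simp [hcard])
  exact ⟨⟨(↑), h, hspan⟩, fun u => rfl⟩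

theorem range_affineBasis (β : AffineBasis T ℝ (EuclideanSpace ℝ (Fin d))) (hβ : ∀ u, β u = u) :
    Set.range β = (T : Set (EuclideanSpace ℝ (Fin d))) := by
  rw [show (β : T → EuclideanSpace ℝ (Fin d)) = (↑) from funext hβ]
  simp

theorem hatFunction_eq_coord (hT : T ∈ K.faces) (β : AffineBasis T ℝ (EuclideanSpace ℝ (Fin d)))
    (hβ : ∀ u, β u = u) (hp : p ∈ convexHull ℝ (T : Set (EuclideanSpace ℝ (Fin d)))) (u : T) :
    hatFunction K u p = β.coord u p := by
  classical
  have hp' : ∀ i, 0 ≤ β.coord i p := by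
    rw [← range_affineBasis β hβ, β.convexHull_eq_nonneg_coord] at hp
    exact hp
  -- Stated for a general monoid because it serves both the scalar sum of the weights and the vector
  -- sum of the weighted vertices.
  have hsum : ∀ {A : Type} [AddCommMonoid A] (f : T → A) ,
      ∑ y ∈ T, (if h : y ∈ T then f ⟨y, h⟩ else 0) = ∑ y, f y := by
    intro A _ f
    rw [← Finset.sum_coe_sort T]
    exact Finset.sum_congr rfl fun y _ => by simp
  have : IsBarycentric K p fun y => if h : y ∈ T then β.coord ⟨y, h⟩ p else 0 := by
    refine ⟨T, hT, fun y => ?_, fun y hy => by simp [hy], ?_, ?_⟩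
    · dsimp only
      split_ifs with h
      exacts [hp' _, le_rfl]
    · rw [hsum fun y => β.coord y p, β.sum_coord_apply_eq_one]
    · conv_rhs => rw [← β.linear_combination_coord_eq_self p]
      rw [← hsum]
      refine Finset.sum_congr rfl fun y hy => ?_
      simp [hy, hβ]
  rw [this.hatFunction_eq, dif_pos u.2]

/-- On a full-dimensional simplex, a hat function is affine. -/
theorem exists_affineMap_eq_hatFunction (hT : T ∈ K.faces) (hcard : T.card = d + 1)
    (v : EuclideanSpace ℝ (Fin d)) : ∃ A : EuclideanSpace ℝ (Fin d) →ᵃ[ℝ] ℝ,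
      ∀ p ∈ convexHull ℝ (T : Set (EuclideanSpace ℝ (Fin d))), hatFunction K v p = A p := by
  obtain ⟨β, hβ⟩ := exists_affineBasis hT hcard
  by_cases hv : v ∈ T
  · exact ⟨β.coord ⟨v, hv⟩, fun p hp => hatFunction_eq_coord hT β hβ hp ⟨v, hv⟩⟩
  · exact ⟨AffineMap.const ℝ _ 0, fun p hp => (hatFunction_spec hT hp).2.1 v hv⟩

theorem hatFunction_pos_of_mem_interior (hT : T ∈ K.faces) (hcard : T.card = d + 1)
    (hp : p ∈ interior (convexHull ℝ (T : Set (EuclideanSpace ℝ (Fin d))))) (hv : v ∈ T) :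
    0 < hatFunction K v p := by
  obtain ⟨β, hβ⟩ := exists_affineBasis hT hcard
  rw [show v = ((⟨v, hv⟩ : T) : EuclideanSpace ℝ (Fin d)) from rfl,
    hatFunction_eq_coord hT β hβ (interior_subset hp)]
  rw [← range_affineBasis β hβ, β.interior_convexHull] at hp
  exact hp _

theorem interior_convexHull_nonempty_of_card (hT : T ∈ K.faces) (hcard : T.card = d + 1) :
    (interior (convexHull ℝ (T : Set (EuclideanSpace ℝ (Fin d))))).Nonempty := by
  obtain ⟨β, hβ⟩ := exists_affineBasis hT hcard
  rw [← range_affineBasis β hβ]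
  exact ⟨_, β.centroid_mem_interior_convexHull⟩

/-- The cells are finitely many closed sets covering the space, and the function is affine on each,
so the pieces glue continuously. -/
theorem continuousOn_hatFunction (hfin : K.faces.Finite)
    (hcard : ∀ T ∈ K.facets, T.card = d + 1) (v : EuclideanSpace ℝ (Fin d)) :
    ContinuousOn (hatFunction K v) K.space := by
  have hff : K.facets.Finite := hfin.subset K.facets_subset
  have : Finite K.facets := hff
  have hc : ContinuousOn (hatFunction K v)
      (⋃ T : K.facets, convexHull ℝ (T.1 : Set (EuclideanSpace ℝ (Fin d)))) := by
    refine (locallyFinite_of_finite _).continuousOn_iUnion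
      (fun T => isCompact_convexHull_finset.isClosed) fun T => ?_
    obtain ⟨A, hA⟩ := exists_affineMap_eq_hatFunction T.2.1 (hcard T.1 T.2) v
    exact (A.continuous_of_finiteDimensional.continuousOn).congr hA
  refine hc.mono fun p hp => ?_
  obtain ⟨T, hT, hpT⟩ := exists_facet_of_mem_space hfin hp
  exact Set.mem_iUnion.2 ⟨⟨T, hT⟩, hpT⟩

/-- A cell containing an interior point of another cell is that cell. -/
theorem facet_eq_of_mem_interior (hT : T ∈ K.facets) (hcard : T.card = d + 1) (hF : F ∈ K.faces)
    (hp : p ∈ interior (convexHull ℝ (T : Set (EuclideanSpace ℝ (Fin d)))))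
    (hpF : p ∈ convexHull ℝ (F : Set (EuclideanSpace ℝ (Fin d)))) : T = F :=
  hT.2 hF fun _ hv => mem_of_hatFunction_ne_zero hF hpF
    (hatFunction_pos_of_mem_interior hT.1 hcard hp hv).ne'

/-- All cells around a vertex in the interior of a union of cells belong to this union. -/
theorem mem_of_vertex_mem_interior_simplexUnion {𝒢 : Set (Finset (EuclideanSpace ℝ (Fin d)))}
    (h𝒢 : 𝒢 ⊆ K.facets) (hT : T ∈ K.facets) (hcard : T.card = d + 1) (hv : v ∈ T)
    (hvG : v ∈ interior (simplexUnion 𝒢)) : T ∈ 𝒢 := by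
  -- A cell is convex with nonempty interior, so its interior points accumulate at each of its
  -- vertices; one of them falls into the union and identifies the cell.
  have hcl : v ∈ closure (interior (convexHull ℝ (T : Set (EuclideanSpace ℝ (Fin d))))) := by
    rw [(convex_convexHull ℝ _).closure_interior_eq_closure_of_nonempty_interior
      (interior_convexHull_nonempty_of_card hT.1 hcard)]
    exact subset_closure (subset_convexHull ℝ _ hv)
  obtain ⟨q, hqG, hqT⟩ := mem_closure_iff.1 hcl _ isOpen_interior hvG
  obtain ⟨F, hF, hqF⟩ := Set.mem_iUnion₂.1 (interior_subset hqG)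
  rwa [facet_eq_of_mem_interior hT hcard (h𝒢 hF).1 hqT hqF]

/-- This confines `φ_v` to the union of cells, so that sign conditions on `g` and `c` there
determine the signs of `(g, φ_v)` and `(c, φ_v)`. -/
theorem mem_simplexUnion_of_hatFunction_ne_zero (hK : IsTriangulation K Ω)
    {𝒢 : Set (Finset (EuclideanSpace ℝ (Fin d)))} (h𝒢 : 𝒢 ⊆ K.facets)
    (hvG : v ∈ interior (simplexUnion 𝒢)) (h : hatFunction K v p ≠ 0) : p ∈ simplexUnion 𝒢 := by
  have hp : p ∈ K.space := by
    by_contra hp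
    exact h (hatFunction_of_notMem_space hp)
  obtain ⟨T, hT, hpT⟩ := exists_facet_of_mem_space hK.finite hp
  exact Set.mem_iUnion₂.2 ⟨T, mem_of_vertex_mem_interior_simplexUnion h𝒢 hT (hK.card_facet T hT)
    (mem_of_hatFunction_ne_zero hT.1 hpT h) hvG, hpT⟩

theorem edgeNeighbours_mem_simplexUnion (hK : IsTriangulation K Ω)
    {𝒢 : Set (Finset (EuclideanSpace ℝ (Fin d)))} (h𝒢 : 𝒢 ⊆ K.facets) {N : ℕ}
    {x : Fin N → EuclideanSpace ℝ (Fin d)} {i j : Fin N} (hi : x i ∈ interior (simplexUnion 𝒢))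
    (hj : j ∈ edgeNeighbours K x i) : x j ∈ simplexUnion 𝒢 := by
  obtain ⟨-, e, he, hxe⟩ := hj
  obtain ⟨T, hT, heT⟩ := exists_facet_of_mem_faces hK.finite he
  have hmem : ∀ k, x k ∈ ({x i, x j} : Set (EuclideanSpace ℝ (Fin d))) → x k ∈ T := fun k hk =>
    heT (by rwa [← hxe] at hk)
  exact Set.mem_iUnion₂.2 ⟨T, mem_of_vertex_mem_interior_simplexUnion h𝒢 hT (hK.card_facet T hT)
    (hmem i (by simp)) hi, subset_convexHull ℝ _ (hmem j (by simp))⟩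

theorem notMem_or_notMem_of_not_edge {N : ℕ} {x : Fin N → EuclideanSpace ℝ (Fin d)} {i j : Fin N}
    (hT : T ∈ K.faces) (hij : j ≠ i) (hj : j ∉ edgeNeighbours K x i) : x i ∉ T ∨ x j ∉ T := by
  classical
  by_contra! h
  refine hj ⟨hij, {x i, x j}, K.down_closed hT ?_ (by simp), by simp⟩
  intro u hu
  rcases Finset.mem_insert.1 hu with rfl | hu
  · exact h.1
  · rw [Finset.mem_singleton.1 hu]
    exact h.2

end HatFunctions

/-! ### Open stars of interior vertices -/

section OpenStar

open Filter Topology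

variable {d : ℕ} {K : SimplicialComplex ℝ (EuclideanSpace ℝ (Fin d))}
  {Ω : Set (EuclideanSpace ℝ (Fin d))}
  {T : Finset (EuclideanSpace ℝ (Fin d))} {v p q : EuclideanSpace ℝ (Fin d)}

/-- Contracting towards `v` by `t` multiplies all barycentric coordinates by `t` and adds the lost
mass `1 - t` at `v`. -/
theorem hatFunction_homothety (hT : T ∈ K.faces) (hv : v ∈ T)
    (hp : p ∈ convexHull ℝ (T : Set (EuclideanSpace ℝ (Fin d)))) {t : ℝ} (h0 : 0 ≤ t)
    (h1 : t ≤ 1) : hatFunction K v (v + t • (p - v)) = 1 - t + t * hatFunction K v p := by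
  classical
  obtain ⟨hn, hz, hs, hsp⟩ := hatFunction_spec hT hp
  have hb : IsBarycentric K (v + t • (p - v))
      fun u => t * hatFunction K u p + if u = v then 1 - t else 0 := by
    refine ⟨T, hT, fun u => ?_, fun u hu => ?_, ?_, ?_⟩
    · have := mul_nonneg h0 (hn u)
      dsimp only
      split_ifs <;> linarith
    · have : u ≠ v := fun h => hu (h ▸ hv)
      simp [hz u hu, this]
    · rw [Finset.sum_add_distrib, ← Finset.mul_sum, hs]
      simp [hv]
    · simp only [add_smul, Finset.sum_add_distrib, mul_smul, ← Finset.smul_sum, hsp, ite_smul,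
        zero_smul, Finset.sum_ite_eq', hv, if_true]
      module
  rw [hb.hatFunction_eq, if_pos rfl]
  ring

/-- Undoing the contraction towards `v` can only make the coordinate at `v` negative, and the bound
`1 - t` is what prevents this. -/
theorem homothety_mem_convexHull (hT : T ∈ K.faces) (hv : v ∈ T)
    (hp : p ∈ convexHull ℝ (T : Set (EuclideanSpace ℝ (Fin d)))) {t : ℝ} (h0 : 0 < t)
    (h1 : 1 - t ≤ hatFunction K v p) :
    v + t⁻¹ • (p - v) ∈ convexHull ℝ (T : Set (EuclideanSpace ℝ (Fin d))) := by
  classical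
  obtain ⟨hn, hz, hs, hsp⟩ := hatFunction_spec hT hp
  refine Finset.mem_convexHull'.2
    ⟨fun u => t⁻¹ * hatFunction K u p + if u = v then 1 - t⁻¹ else 0, fun u _ => ?_, ?_, ?_⟩
  · have h2 := mul_nonneg (inv_nonneg.2 h0.le) (hn u)
    dsimp only
    split_ifs with h
    · subst h
      have h3 : t⁻¹ * (1 - t) ≤ t⁻¹ * hatFunction K u p :=
        mul_le_mul_of_nonneg_left h1 (inv_nonneg.2 h0.le)
      have h4 : t⁻¹ * (1 - t) = t⁻¹ - 1 := by field_simp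
      linarith
    · linarith
  · rw [Finset.sum_add_distrib, ← Finset.mul_sum, hs]
    simp [hv]
  · simp only [add_smul, Finset.sum_add_distrib, mul_smul, ← Finset.smul_sum, hsp, ite_smul,
      zero_smul, Finset.sum_ite_eq', hv, if_true]
    module

/-- The open star of an interior vertex consists of interior points. -/
theorem mem_interior_space_of_hatFunction_ne_zero (hfin : K.faces.Finite)
    (hcard : ∀ T ∈ K.facets, T.card = d + 1) (hv : v ∈ interior K.space)
    (hp : hatFunction K v p ≠ 0) : p ∈ interior K.space := by
  have hps : p ∈ K.space := by
    by_contra h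
    exact hp (hatFunction_of_notMem_space h)
  obtain ⟨T, hT, hpT⟩ := SimplicialComplex.mem_space_iff.1 hps
  have hvT := mem_of_hatFunction_ne_zero hT hpT hp
  have hpos : 0 < hatFunction K v p := lt_of_le_of_ne hatFunction_nonneg (Ne.symm hp)
  obtain ⟨t, ht0, ht1, ht⟩ :
      ∃ t : ℝ, 0 < t ∧ t < 1 ∧ v + t • (p - v) ∈ interior K.space := by
    have hc : Tendsto (fun t : ℝ => v + t • (p - v)) (𝓝[>] 0) (𝓝 v) := by
      have : ContinuousAt (fun t : ℝ => v + t • (p - v)) 0 := by fun_prop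
      have h := this.tendsto
      simp only [zero_smul, add_zero] at h
      exact h.mono_left nhdsWithin_le_nhds
    have h1 := hc.eventually (isOpen_interior.mem_nhds hv)
    have h2 : ∀ᶠ t : ℝ in 𝓝[>] 0, t ∈ Set.Ioo (0 : ℝ) 1 := Ioo_mem_nhdsGT one_pos
    obtain ⟨t, h, h'⟩ := (h1.and h2).exists
    exact ⟨t, h'.1, h'.2, h⟩
  -- The contraction `z` moves `p` into the interior of the space. For `y` near `p`, the point `z y`
  -- lies in some face with coordinate at `v` above `1 - t`; that face contains `v`, and expanding
  -- back from `v` stays in it, so `y` is in the space.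
  set z : EuclideanSpace ℝ (Fin d) → EuclideanSpace ℝ (Fin d) := fun y => v + t • (y - v) with hz
  have hzc : ContinuousAt z p := by fun_prop
  have hhat : ContinuousAt (hatFunction K v) (z p) :=
    (continuousOn_hatFunction hfin hcard v).continuousAt (mem_interior_iff_mem_nhds.1 ht)
  have hval : 1 - t < hatFunction K v (z p) := by
    rw [hz, hatFunction_homothety hT hvT hpT ht0.le ht1.le]
    linarith [mul_pos ht0 hpos]
  rw [mem_interior_iff_mem_nhds]
  filter_upwards [hzc.eventually (isOpen_interior.mem_nhds ht),
    (hhat.comp hzc).eventually (lt_mem_nhds hval)] with y hy1 hy2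
  obtain ⟨F, hF, hyF⟩ := SimplicialComplex.mem_space_iff.1 (interior_subset hy1)
  have hvF : v ∈ F :=
    mem_of_hatFunction_ne_zero hF hyF (lt_trans (by linarith) hy2 : 0 < hatFunction K v (z y)).ne'
  have := homothety_mem_convexHull hF hvF hyF ht0 hy2.le
  have hyz : v + t⁻¹ • (z y - v) = y := by
    simp [hz, smul_smul, inv_mul_cancel₀ ht0.ne']
  rw [hyz] at this
  exact SimplicialComplex.mem_space_iff.2 ⟨F, hF, this⟩

end OpenStar

/-! ### Lipschitz bounds from a finite closed cover -/

section LipschitzCover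

open scoped NNReal

/-- Induction on the number of sets: go from `a` to the last point `t` of a set containing `a`.
Beyond `t` that set is no longer needed, and closedness of the others extends their cover of `(t,
b]` to `t` itself. -/
theorem abs_sub_le_of_finite_closed_cover {ι : Type*} {F : ι → Set ℝ} (hF : ∀ i, IsClosed (F i))
    {f : ℝ → ℝ} {L : ℝ} (hf : ∀ i, ∀ x ∈ F i, ∀ y ∈ F i, |f x - f y| ≤ L * |x - y|) {b : ℝ}
    (s : Finset ι) : ∀ a ≤ b, (∀ t ∈ Set.Icc a b, ∃ i ∈ s, t ∈ F i) →
      |f b - f a| ≤ L * (b - a) := by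
  classical
  induction hn : s.card generalizing s with
  | zero =>
    intro a hab h
    obtain ⟨i, hi, -⟩ := h a (Set.left_mem_Icc.2 hab)
    rw [Finset.card_eq_zero.1 hn] at hi
    simp at hi
  | succ n ih =>
    intro a hab h
    obtain ⟨i, hi, hai⟩ := h a (Set.left_mem_Icc.2 hab)
    have hcpt : IsCompact (F i ∩ Set.Icc a b) := isCompact_Icc.inter_left (hF i)
    obtain ⟨t, ⟨htF, hat, htb⟩, hmax⟩ :=
      hcpt.exists_isGreatest ⟨a, hai, Set.left_mem_Icc.2 hab⟩
    have h1 : |f t - f a| ≤ L * (t - a) := by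
      have := hf i t htF a hai
      rwa [abs_of_nonneg (sub_nonneg.2 hat)] at this
    rcases htb.eq_or_lt with rfl | htb
    · exact h1
    have hIoc : Set.Ioc t b ⊆ ⋃ j ∈ s.erase i, F j := by
      intro r hr
      obtain ⟨j, hj, hrj⟩ := h r ⟨hat.trans hr.1.le, hr.2⟩
      have hji : j ≠ i := by
        rintro rfl
        exact absurd (hmax ⟨hrj, hat.trans hr.1.le, hr.2⟩) (not_le.2 hr.1)
      exact Set.mem_iUnion₂.2 ⟨j, Finset.mem_erase.2 ⟨hji, hj⟩, hrj⟩
    have hcl : IsClosed (⋃ j ∈ s.erase i, F j) :=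
      (s.erase i).finite_toSet.isClosed_biUnion fun j _ => hF j
    have hIcc : Set.Icc t b ⊆ ⋃ j ∈ s.erase i, F j := by
      rw [← closure_Ioc htb.ne]
      exact hcl.closure_subset_iff.2 hIoc
    have h2 := ih (s.erase i) (by rw [Finset.card_erase_of_mem hi, hn]; rfl) t htb.le
      fun r hr => by simpa using hIcc hr
    calc |f b - f a| ≤ |f b - f t| + |f t - f a| := abs_sub_le _ _ _
      _ ≤ L * (b - t) + L * (t - a) := add_le_add h2 h1
      _ = L * (b - a) := by ring

/-- A function that is Lipschitz on each member of a finite closed cover of a normed space is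
Lipschitz. -/
theorem lipschitzWith_of_finite_closed_cover {E ι : Type*} [NormedAddCommGroup E]
    [NormedSpace ℝ E] [Fintype ι] {F : ι → Set E} (hF : ∀ i, IsClosed (F i))
    (hcover : ∀ x, ∃ i, x ∈ F i) {f : E → ℝ} {L : ℝ≥0} (hf : ∀ i, LipschitzOnWith L f (F i)) :
    LipschitzWith L f := by
  refine LipschitzWith.of_dist_le_mul fun p q => ?_
  have hγ : Continuous fun t : ℝ => q + t • (p - q) := by fun_prop
  have h := abs_sub_le_of_finite_closed_cover
    (F := fun i => (fun t : ℝ => q + t • (p - q)) ⁻¹' F i) (fun i => (hF i).preimage hγ)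
    (f := fun t => f (q + t • (p - q))) (L := L * dist p q) (b := 1) (fun i s hs t ht => ?_)
    Finset.univ 0 zero_le_one fun t _ => by simpa using hcover (q + t • (p - q))
  · simpa [Real.dist_eq] using h
  · have h1 := (hf i).dist_le_mul _ hs _ ht
    rw [Real.dist_eq] at h1
    refine h1.trans (le_of_eq ?_)
    rw [dist_add_left, dist_eq_norm, ← sub_smul, norm_smul, dist_eq_norm, Real.norm_eq_abs]
    ring

end LipschitzCover

/-! ### Gradients and Lipschitz continuity of hat functions -/

section Gradients

open Filter Topology
open scoped NNReal

variable {d : ℕ} {K : SimplicialComplex ℝ (EuclideanSpace ℝ (Fin d))}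
  {Ω : Set (EuclideanSpace ℝ (Fin d))}
  {T : Finset (EuclideanSpace ℝ (Fin d))} {v p q : EuclideanSpace ℝ (Fin d)}

/-- On a cell, a hat function has a constant gradient and is affine. -/
theorem exists_gradient_hatFunction (hT : T ∈ K.faces) (hcard : T.card = d + 1)
    (v : EuclideanSpace ℝ (Fin d)) : ∃ G : EuclideanSpace ℝ (Fin d),
      (∀ p ∈ interior (convexHull ℝ (T : Set (EuclideanSpace ℝ (Fin d)))),
        HasGradientAt (hatFunction K v) G p) ∧
      ∀ p ∈ convexHull ℝ (T : Set (EuclideanSpace ℝ (Fin d))),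
        ∀ q ∈ convexHull ℝ (T : Set (EuclideanSpace ℝ (Fin d))),
          hatFunction K v p - hatFunction K v q = inner ℝ G (p - q) := by
  obtain ⟨A, hA⟩ := exists_affineMap_eq_hatFunction hT hcard v
  refine ⟨(InnerProductSpace.toDual ℝ _).symm (LinearMap.toContinuousLinearMap A.linear),
    fun p hp => ?_, fun p hp q hq => ?_⟩
  · rw [hasGradientAt_iff_hasFDerivAt, LinearIsometryEquiv.apply_symm_apply]
    have h1 : HasFDerivAt A (LinearMap.toContinuousLinearMap A.linear) p := by
      rw [A.decomp]
      exact (LinearMap.toContinuousLinearMap A.linear).hasFDerivAt.add_const _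
    refine h1.congr_of_eventuallyEq ?_
    filter_upwards [isOpen_interior.mem_nhds hp] with y hy
    exact hA y (interior_subset hy)
  · rw [InnerProductSpace.toDual_symm_apply, hA p hp, hA q hq]
    have := A.linearMap_vsub p q
    simp only [vsub_eq_sub] at this
    simp [this]

/-- The open star of an interior vertex lies in the interior of the triangulated set, which is `Ω`
itself because `Ω` is the interior of its closure. -/
theorem hatFunction_eq_zero_of_notMem (hΩ_reg : interior (closure Ω) = Ω)
    (hK : IsTriangulation K Ω) (hv : v ∈ Ω) (hp : p ∉ Ω) : hatFunction K v p = 0 := by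
  by_contra h
  rw [← hΩ_reg, ← hK.space_eq] at hv hp
  exact hp (mem_interior_space_of_hatFunction_ne_zero hK.finite hK.card_facet hv h)

/-- The cells and the complement of `Ω` form a finite closed cover of the whole space; the function
is affine on the former and zero on the latter. -/
theorem exists_lipschitzWith_hatFunction (hΩ_open : IsOpen Ω) (hΩ_reg : interior (closure Ω) = Ω)
    (hK : IsTriangulation K Ω) (hv : v ∈ Ω) : ∃ L : ℝ≥0, LipschitzWith L (hatFunction K v) := by
  have hff : K.facets.Finite := hK.finite.subset K.facets_subset
  have : Fintype K.facets := hff.fintype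
  choose G _ hG using fun T : K.facets =>
    exists_gradient_hatFunction T.2.1 (hK.card_facet T.1 T.2) v
  refine ⟨∑ T, ‖G T‖₊, lipschitzWith_of_finite_closed_cover (ι := Option K.facets)
    (F := fun o => o.elim Ωᶜ fun T => convexHull ℝ (T.1 : Set (EuclideanSpace ℝ (Fin d))))
    (fun o => ?_) (fun p => ?_) fun o => ?_⟩
  · cases o
    exacts [hΩ_open.isClosed_compl, isCompact_convexHull_finset.isClosed]
  · by_cases hp : p ∈ Ω
    · obtain ⟨T, hT, hpT⟩ := exists_facet_of_mem_space hK.finite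
        (hK.space_eq ▸ subset_closure hp : p ∈ K.space)
      exact ⟨some ⟨T, hT⟩, hpT⟩
    · exact ⟨none, hp⟩
  · refine LipschitzOnWith.of_dist_le_mul fun p hp q hq => ?_
    cases o with
    | none =>
      rw [hatFunction_eq_zero_of_notMem hΩ_reg hK hv hp,
        hatFunction_eq_zero_of_notMem hΩ_reg hK hv hq, dist_self]
      positivity
    | some T =>
      rw [Real.dist_eq, hG T p hp q hq, dist_eq_norm]
      refine (abs_real_inner_le_norm _ _).trans (mul_le_mul_of_nonneg_right ?_ (norm_nonneg _))
      rw [← coe_nnnorm, NNReal.coe_le_coe]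
      exact Finset.single_le_sum (f := fun T => ‖G T‖₊) (fun _ _ => zero_le) (Finset.mem_univ T)

/-- Almost every point lies in the interior of a cell. -/
theorem ae_mem_interior_facet (hK : IsTriangulation K Ω) :
    ∀ᵐ p ∂volume.restrict Ω, ∃ T ∈ K.facets,
      p ∈ interior (convexHull ℝ (T : Set (EuclideanSpace ℝ (Fin d)))) := by
  have hff : K.facets.Finite := hK.finite.subset K.facets_subset
  have hfr : ∀ᵐ p ∂(volume : Measure (EuclideanSpace ℝ (Fin d))), ∀ T ∈ K.facets,
      p ∉ frontier (convexHull ℝ (T : Set (EuclideanSpace ℝ (Fin d)))) := by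
    rw [ae_ball_iff hff.countable]
    intro T _
    exact measure_eq_zero_iff_ae_notMem.1 ((convex_convexHull ℝ _).addHaar_frontier volume)
  have hΩ : ∀ᵐ p ∂volume.restrict Ω, p ∈ closure Ω := by
    refine ae_mono (Measure.restrict_mono subset_closure le_rfl) ?_
    exact ae_restrict_mem isClosed_closure.measurableSet
  filter_upwards [ae_restrict_of_ae hfr, hΩ] with p hp hpΩ
  obtain ⟨T, hT, hpT⟩ := exists_facet_of_mem_space hK.finite (hK.space_eq ▸ hpΩ : p ∈ K.space)
  refine ⟨T, hT, ?_⟩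
  by_contra h
  exact hp T hT ⟨subset_closure hpT, h⟩

theorem ae_differentiableAt_hatFunction (hK : IsTriangulation K Ω) :
    ∀ᵐ p ∂volume.restrict Ω, ∀ v, DifferentiableAt ℝ (hatFunction K v) p := by
  filter_upwards [ae_mem_interior_facet hK] with p ⟨T, hT, hp⟩ v
  obtain ⟨G, hG, -⟩ := exists_gradient_hatFunction hT.1 (hK.card_facet T hT) v
  exact (hG p hp).differentiableAt

theorem exists_ae_norm_gradient_le (hK : IsTriangulation K Ω) (v : EuclideanSpace ℝ (Fin d)) :
    ∃ C : ℝ, ∀ᵐ p ∂volume.restrict Ω, ‖gradient (hatFunction K v) p‖ ≤ C := by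
  have hff : K.facets.Finite := hK.finite.subset K.facets_subset
  have : Fintype K.facets := hff.fintype
  choose G hG _ using fun T : K.facets =>
    exists_gradient_hatFunction T.2.1 (hK.card_facet T.1 T.2) v
  refine ⟨∑ T, ‖G T‖, ?_⟩
  filter_upwards [ae_mem_interior_facet hK] with p ⟨T, hT, hp⟩
  rw [(hG ⟨T, hT⟩ p hp).gradient]
  exact Finset.single_le_sum (f := fun T => ‖G T‖) (fun _ _ => norm_nonneg _)
    (Finset.mem_univ (⟨T, hT⟩ : K.facets))

theorem measurable_gradient (f : EuclideanSpace ℝ (Fin d) → ℝ) : Measurable (gradient f) :=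
  (InnerProductSpace.toDual ℝ _).symm.continuous.measurable.comp (measurable_fderiv ℝ f)

end Gradients

/-! ### Skew-symmetry of divergence-free convection -/

section DivergenceFree

open Filter Topology
open scoped NNReal Convolution

variable {d : ℕ} {Ω : Set (EuclideanSpace ℝ (Fin d))}
  {b : EuclideanSpace ℝ (Fin d) → EuclideanSpace ℝ (Fin d)}

theorem inner_gradient_eq_fderiv (f : EuclideanSpace ℝ (Fin d) → ℝ)
    (y p : EuclideanSpace ℝ (Fin d)) : inner ℝ y (gradient f p) = fderiv ℝ f p y := by
  rw [real_inner_comm, gradient, InnerProductSpace.toDual_symm_apply]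

/-- The mollification of a Lipschitz function can be differentiated under the integral sign. -/
theorem LipschitzWith.hasFDerivAt_normed_convolution {w : EuclideanSpace ℝ (Fin d) → ℝ} {L : ℝ≥0}
    (hw : LipschitzWith L w) (φ : ContDiffBump (0 : EuclideanSpace ℝ (Fin d)))
    (p : EuclideanSpace ℝ (Fin d)) :
    HasFDerivAt (φ.normed volume ⋆[ContinuousLinearMap.lsmul ℝ ℝ, volume] w)
      ((φ.normed volume ⋆[ContinuousLinearMap.lsmul ℝ ℝ, volume] fderiv ℝ w) p) p := by
  have hmeas : Measurable (fderiv ℝ w) := measurable_fderiv ℝ w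
  refine (hasFDerivAt_integral_of_dominated_loc_of_lip (𝕜 := ℝ)
    (F := fun p y => φ.normed volume y • w (p - y))
    (F' := fun y => φ.normed volume y • fderiv ℝ w (p - y))
    (bound := fun y => L * φ.normed volume y) univ_mem (Eventually.of_forall fun q => ?_)
    ?_ ?_ (ae_of_all _ fun y => ?_) (φ.integrable_normed.const_mul _) ?_).2
  · exact (φ.continuous_normed.smul
      (hw.continuous.comp (continuous_const.sub continuous_id))).aestronglyMeasurable
  · exact (φ.continuous_normed.smul (hw.continuous.comp
      (continuous_const.sub continuous_id))).integrable_of_hasCompactSupport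
        φ.hasCompactSupport_normed.smul_right
  · exact (φ.continuous_normed.measurable.smul
      (hmeas.comp (measurable_const.sub measurable_id))).aestronglyMeasurable
  · have hφ : 0 ≤ φ.normed volume y := φ.nonneg_normed y
    refine LipschitzOnWith.of_dist_le_mul fun q _ r _ => ?_
    rw [Real.coe_nnabs, abs_of_nonneg (mul_nonneg L.coe_nonneg hφ), dist_eq_norm, ← smul_sub, norm_smul,
      Real.norm_of_nonneg hφ, ← dist_eq_norm]
    have := hw.dist_le_mul (q - y) (r - y)
    rw [dist_sub_right] at this
    calc φ.normed volume y * dist (w (q - y)) (w (r - y))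
        ≤ φ.normed volume y * (L * dist q r) := mul_le_mul_of_nonneg_left this hφ
      _ = L * φ.normed volume y * dist q r := by ring
  -- Rademacher's theorem, transported by `y ↦ p - y`, gives differentiability at `p - y` for almost
  -- every `y`.
  · have hae : ∀ᵐ z ∂(volume : Measure (EuclideanSpace ℝ (Fin d))), DifferentiableAt ℝ w z :=
      hw.ae_differentiableAt
    have hq := (quasiMeasurePreserving_sub_left
      (volume : Measure (EuclideanSpace ℝ (Fin d))) p).ae hae
    filter_upwards [hq] with y hy
    have h1 : HasFDerivAt (fun q => w (q - y)) (fderiv ℝ w (p - y)) p :=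
      hy.hasFDerivAt.comp p ((hasFDerivAt_id p).sub_const y)
    exact h1.const_smul (φ.normed volume y)

/-- Mollifications of `w` are admissible test functions. Their gradients are bounded by `L` and
converge almost everywhere, so dominated convergence applies. -/
theorem integral_inner_gradient_eq_zero_of_tsupport_subset (hΩ_open : IsOpen Ω)
    (hΩ_bdd : Bornology.IsBounded Ω) (hb_meas : AEStronglyMeasurable b (volume.restrict Ω))
    {C : ℝ} (hbC : ∀ᵐ p ∂volume.restrict Ω, ‖b p‖ ≤ C) (hb_div : IsWeaklyDivFree Ω b)
    {w : EuclideanSpace ℝ (Fin d) → ℝ} {L : ℝ≥0} (hw : LipschitzWith L w)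
    (hwΩ : tsupport w ⊆ Ω) : ∫ p in Ω, inner ℝ (b p) (gradient w p) = 0 := by
  have hcs : IsCompact (tsupport w) :=
    Metric.isCompact_of_isClosed_isBounded (isClosed_tsupport w) (hΩ_bdd.subset hwΩ)
  obtain ⟨δ, hδ, hδΩ⟩ := hcs.exists_cthickening_subset_open hΩ_open hwΩ
  have hpos : ∀ n : ℕ, (0 : ℝ) < δ / 2 * (1 / (n + 1)) := fun n => by positivity
  -- The outer radius is at most `δ`, which keeps supports inside `Ω`, and exactly twice the inner
  -- one: the bounded ratio needed for almost everywhere convergence.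
  set φ : ℕ → ContDiffBump (0 : EuclideanSpace ℝ (Fin d)) := fun n =>
    ⟨δ / 2 * (1 / (n + 1)), 2 * (δ / 2 * (1 / (n + 1))), hpos n, by linarith [hpos n]⟩ with hφ
  have hφ0 : Tendsto (fun n => (φ n).rOut) atTop (𝓝 0) := by
    have h := (tendsto_one_div_add_atTop_nhds_zero_nat (𝕜 := ℝ)).const_mul (δ / 2) |>.const_mul 2
    simp only [mul_zero] at h
    exact h
  have hφδ : ∀ n, (φ n).rOut ≤ δ := fun n => by
    have h1 : (1 : ℝ) / (n + 1) ≤ 1 := by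
      rw [div_le_one (by positivity)]
      linarith [(Nat.cast_nonneg n : (0 : ℝ) ≤ n)]
    have : δ / 2 * (1 / (n + 1)) ≤ δ / 2 * 1 := mul_le_mul_of_nonneg_left h1 (by positivity)
    change 2 * (δ / 2 * (1 / ((n : ℝ) + 1))) ≤ δ
    linarith
  set ψ : ℕ → EuclideanSpace ℝ (Fin d) → ℝ := fun n =>
    (φ n).normed volume ⋆[ContinuousLinearMap.lsmul ℝ ℝ, volume] w with hψ
  have hsupp : ∀ n, tsupport (ψ n) ⊆ Metric.cthickening δ (tsupport w) := fun n => by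
    refine closure_minimal ?_ Metric.isClosed_cthickening
    refine (support_convolution_subset _).trans ?_
    rintro _ ⟨y, hy, z, hz, rfl⟩
    rw [(φ n).support_normed_eq, mem_ball_zero_iff] at hy
    refine Metric.mem_cthickening_of_dist_le _ z _ _ (subset_tsupport _ hz) ?_
    rw [dist_eq_norm, add_sub_cancel_right]
    exact hy.le.trans (hφδ n)
  have hψ_int : ∀ n, ∫ p in Ω, inner ℝ (b p) (gradient (ψ n) p) = 0 := fun n =>
    hb_div (ψ n)
      ((φ n).hasCompactSupport_normed.contDiff_convolution_left _ (φ n).contDiff_normed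
        hw.continuous.locallyIntegrable)
      (hcs.cthickening.of_isClosed_subset (isClosed_tsupport _) (hsupp n))
      ((hsupp n).trans hδΩ)
  have hloc : LocallyIntegrable (fderiv ℝ w) volume := by
    refine (memLp_top_of_bound (measurable_fderiv ℝ w).aestronglyMeasurable L
      (ae_of_all _ fun p => norm_fderiv_le_of_lipschitz ℝ hw)).locallyIntegrable le_top
  have hlim : ∀ᵐ p ∂(volume : Measure (EuclideanSpace ℝ (Fin d))),
      Tendsto (fun n => fderiv ℝ (ψ n) p) atTop (𝓝 (fderiv ℝ w p)) := by
    filter_upwards [ContDiffBump.ae_convolution_tendsto_right_of_locallyIntegrable (K := 2) hφ0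
      (Eventually.of_forall fun n => le_rfl) hloc] with p hp
    refine hp.congr fun n => ?_
    rw [(hw.hasFDerivAt_normed_convolution (φ n) p).fderiv]
  have hbound : ∀ n p, ‖fderiv ℝ (ψ n) p‖ ≤ L := fun n p => by
    rw [(hw.hasFDerivAt_normed_convolution (φ n) p).fderiv]
    refine (norm_integral_le_of_norm_le (((φ n).integrable_normed (μ := volume)).mul_const (L : ℝ))
      (ae_of_all _ fun y => ?_)).trans ?_
    · rw [ContinuousLinearMap.lsmul_apply, norm_smul,
        Real.norm_of_nonneg ((φ n).nonneg_normed y)]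
      exact mul_le_mul_of_nonneg_left (norm_fderiv_le_of_lipschitz ℝ hw) ((φ n).nonneg_normed y)
    · rw [integral_mul_const, (φ n).integral_normed, one_mul]
  have hfin : IsFiniteMeasure (volume.restrict Ω) := ⟨by
    simpa using hΩ_bdd.measure_lt_top⟩
  have hT : Tendsto (fun n => ∫ p in Ω, inner ℝ (b p) (gradient (ψ n) p)) atTop
      (𝓝 (∫ p in Ω, inner ℝ (b p) (gradient w p))) := by
    refine tendsto_integral_of_dominated_convergence (fun _ => L * C) (fun n => ?_)
      (integrable_const _) (fun n => ?_) ?_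
    · exact hb_meas.inner (measurable_gradient _).aestronglyMeasurable
    · filter_upwards [hbC] with p hp
      rw [inner_gradient_eq_fderiv]
      exact (ContinuousLinearMap.le_opNorm _ _).trans
        (mul_le_mul (hbound n p) hp (norm_nonneg _) L.coe_nonneg)
    · filter_upwards [ae_restrict_of_ae hlim] with p hp
      simp only [inner_gradient_eq_fderiv]
      exact ((ContinuousLinearMap.apply ℝ ℝ (b p)).continuous.tendsto _).comp hp
  simp only [hψ_int] at hT
  exact (tendsto_const_nhds_iff.1 hT).symm

/-- Squaring removes the kink at 0, so the chain rule holds wherever the inner function is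
differentiable. -/
theorem hasDerivAt_max_zero_sq (t : ℝ) :
    HasDerivAt (fun s : ℝ => max s 0 ^ 2) (2 * max t 0) t := by
  rcases lt_trichotomy t 0 with h | rfl | h
  · rw [max_eq_right h.le, mul_zero]
    refine (hasDerivAt_const t (0 : ℝ)).congr_of_eventuallyEq ?_
    filter_upwards [Iio_mem_nhds h] with s hs
    simp [max_eq_right (le_of_lt (Set.mem_Iio.1 hs))]
  · rw [max_self, mul_zero, hasDerivAt_iff_hasFDerivAt]
    have : HasFDerivAt (fun s : ℝ => max s 0 ^ 2) (0 : ℝ →L[ℝ] ℝ) 0 := by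
      refine Asymptotics.IsBigO.hasFDerivAt (n := 2)
        (Asymptotics.isBigO_of_le _ fun s => ?_) one_lt_two
      rw [norm_pow, norm_pow, sub_zero, norm_norm]
      refine pow_le_pow_left₀ (norm_nonneg _) ?_ 2
      rw [Real.norm_eq_abs, Real.norm_eq_abs, abs_of_nonneg (le_max_right _ _)]
      exact max_le (le_abs_self _) (abs_nonneg _)
    rwa [ContinuousLinearMap.toSpanSingleton_zero]
  · rw [max_eq_left h.le]
    have h1 : HasDerivAt (fun s : ℝ => s ^ 2) (2 * t) t := by simpa using hasDerivAt_pow 2 t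
    refine h1.congr_of_eventuallyEq ?_
    filter_upwards [Ioi_mem_nhds h] with s hs
    simp [max_eq_left (le_of_lt (Set.mem_Ioi.1 hs))]

/-- A divergence-free convection field is skew-symmetric on Lipschitz functions that vanish
outside the domain. -/
theorem integral_inner_gradient_mul_self_eq_zero (hΩ_open : IsOpen Ω)
    (hΩ_bdd : Bornology.IsBounded Ω) (hb_meas : AEStronglyMeasurable b (volume.restrict Ω))
    {C : ℝ} (hbC : ∀ᵐ p ∂volume.restrict Ω, ‖b p‖ ≤ C) (hb_div : IsWeaklyDivFree Ω b)
    {v : EuclideanSpace ℝ (Fin d) → ℝ} {L : ℝ≥0} (hv : LipschitzWith L v)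
    (hv0 : ∀ p, 0 ≤ v p) {R : ℝ} (hvR : ∀ p, v p ≤ R) (hvΩ : ∀ p, p ∉ Ω → v p = 0) :
    ∫ p in Ω, inner ℝ (b p) (gradient v p) * v p = 0 := by
  have hR : 0 ≤ R := (hv0 0).trans (hvR 0)
  have hfin : IsFiniteMeasure (volume.restrict Ω) := ⟨by
    simpa using hΩ_bdd.measure_lt_top⟩
  have hC : ∀ᵐ p ∂volume.restrict Ω, 0 ≤ C := by
    filter_upwards [hbC] with p hp using (norm_nonneg _).trans hp
  have hdiff : ∀ᵐ p ∂volume.restrict Ω, DifferentiableAt ℝ v p :=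
    ae_restrict_of_ae hv.ae_differentiableAt
  set δ : ℕ → ℝ := fun n => 1 / ((n : ℝ) + 1) with hδ
  have hδ0 : ∀ n, 0 < δ n := fun n => by positivity
  -- The truncated square `(v - δ)₊²` approximates `v²`, and its support lies in the closed set `{v
  -- ≥ δ}`, hence inside `Ω`. Its gradient is `2 (v - δ)₊ ∇v`, so the limit `δ → 0` yields `2 v ∇v`.
  set w : ℕ → EuclideanSpace ℝ (Fin d) → ℝ := fun n p => max (v p - δ n) 0 ^ 2 with hw
  have hmaxR : ∀ n p, max (v p - δ n) 0 ≤ R := fun n p =>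
    max_le (by linarith [hvR p, hδ0 n]) hR
  have hwlip : ∀ n, LipschitzWith (2 * R.toNNReal * L) (w n) := fun n => by
    refine LipschitzWith.of_dist_le_mul fun p q => ?_
    have h1 : |max (v p - δ n) 0 - max (v q - δ n) 0| ≤ L * dist p q := by
      refine (abs_max_sub_max_le_abs _ _ _).trans ?_
      rw [sub_sub_sub_cancel_right, ← Real.dist_eq]
      exact hv.dist_le_mul p q
    have h2 : |max (v p - δ n) 0 + max (v q - δ n) 0| ≤ 2 * R := by
      rw [abs_of_nonneg (add_nonneg (le_max_right _ _) (le_max_right _ _))]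
      linarith [hmaxR n p, hmaxR n q]
    rw [Real.dist_eq, sq_sub_sq, abs_mul]
    calc _ ≤ 2 * R * (L * dist p q) := mul_le_mul h2 h1 (abs_nonneg _) (by positivity)
      _ = _ := by
        push_cast
        rw [Real.coe_toNNReal R hR]
        ring
  have hwsupp : ∀ n, tsupport (w n) ⊆ Ω := fun n => by
    have hcl : IsClosed {p | δ n ≤ v p} := isClosed_le continuous_const hv.continuous
    refine (closure_minimal (fun p hp => ?_) hcl).trans fun p hp => ?_
    · by_contra h
      refine hp ?_
      simp only [Set.mem_ofPred_eq, not_le] at h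
      simp [hw, max_eq_right (by linarith : v p - δ n ≤ 0)]
    · by_contra h
      have h1 : δ n ≤ v p := hp
      rw [hvΩ p h] at h1
      exact absurd (hδ0 n) (not_lt.2 h1)
  have hzero : ∀ n, ∫ p in Ω, inner ℝ (b p) (gradient (w n) p) = 0 := fun n =>
    integral_inner_gradient_eq_zero_of_tsupport_subset hΩ_open hΩ_bdd hb_meas hbC hb_div
      (hwlip n) (hwsupp n)
  have hgrad : ∀ n, ∀ᵐ p ∂volume.restrict Ω, inner ℝ (b p) (gradient (w n) p) =
      2 * max (v p - δ n) 0 * inner ℝ (b p) (gradient v p) := fun n => by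
    filter_upwards [hdiff] with p hp
    have h1 := (hasDerivAt_max_zero_sq (v p - δ n)).comp_hasFDerivAt p
      (hp.hasFDerivAt.sub_const (δ n))
    simp only [inner_gradient_eq_fderiv]
    rw [show w n = (fun s : ℝ => max s 0 ^ 2) ∘ fun p => v p - δ n from rfl, h1.fderiv]
    simp
  have hT : Tendsto (fun n => ∫ p in Ω, 2 * max (v p - δ n) 0 * inner ℝ (b p) (gradient v p))
      atTop (𝓝 (∫ p in Ω, 2 * (inner ℝ (b p) (gradient v p) * v p))) := by
    refine tendsto_integral_of_dominated_convergence (fun _ => 2 * R * (L * C)) (fun n => ?_)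
      (integrable_const _) (fun n => ?_) (ae_of_all _ fun p => ?_)
    · have hc : Continuous fun p => 2 * max (v p - δ n) 0 :=
        continuous_const.mul ((hv.continuous.sub continuous_const).max continuous_const)
      exact hc.aestronglyMeasurable.mul
        (hb_meas.inner (measurable_gradient _).aestronglyMeasurable)
    · filter_upwards [hbC] with p hp
      rw [norm_mul, inner_gradient_eq_fderiv]
      refine mul_le_mul ?_ ((ContinuousLinearMap.le_opNorm _ _).trans
        (mul_le_mul (norm_fderiv_le_of_lipschitz ℝ hv) hp (norm_nonneg _) L.coe_nonneg)) (norm_nonneg _)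
        (by positivity)
      rw [Real.norm_of_nonneg (mul_nonneg zero_le_two (le_max_right _ _))]
      linarith [hmaxR n p]
    · have h0 : Tendsto δ atTop (𝓝 0) := tendsto_one_div_add_atTop_nhds_zero_nat
      have h1 : Tendsto (fun n => max (v p - δ n) 0) atTop (𝓝 (max (v p - 0) 0)) :=
        (tendsto_const_nhds.sub h0).max tendsto_const_nhds
      rw [sub_zero, max_eq_left (hv0 p)] at h1
      have h2 := (h1.const_mul 2).mul_const (inner ℝ (b p) (gradient v p))
      convert h2 using 2
      ring
  have hval : ∀ n, ∫ p in Ω, 2 * max (v p - δ n) 0 * inner ℝ (b p) (gradient v p) = 0 :=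
    fun n => (integral_congr_ae (hgrad n)).symm.trans (hzero n)
  simp only [hval] at hT
  have := tendsto_const_nhds_iff.1 hT
  rw [integral_const_mul] at this
  linarith

theorem exists_ae_norm_le_of_memLp_top (hb : ∀ k : Fin d, MemLp (fun p => b p k) ⊤
    (volume.restrict Ω)) : AEStronglyMeasurable b (volume.restrict Ω) ∧
      ∃ C : ℝ, ∀ᵐ p ∂volume.restrict Ω, ‖b p‖ ≤ C := by
  have h : MemLp b ⊤ (volume.restrict Ω) := MemLp.of_eval_piLp hb
  refine ⟨h.1, (eLpNormEssSup b (volume.restrict Ω)).toReal, ?_⟩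
  have hlt := h.2
  rw [eLpNorm_exponent_top] at hlt
  filter_upwards [ae_le_eLpNormEssSup (f := b) (μ := volume.restrict Ω)] with p hp
  rw [← toReal_enorm]
  exact ENNReal.toReal_mono hlt.ne hp

end DivergenceFree

/-! ### Row sums, sparsity and positivity of the finite element matrix -/

section DiscreteForms

open Filter Topology
open scoped NNReal

variable {d : ℕ} {K : SimplicialComplex ℝ (EuclideanSpace ℝ (Fin d))}
  {Ω : Set (EuclideanSpace ℝ (Fin d))} {T : Finset (EuclideanSpace ℝ (Fin d))}
  {v p : EuclideanSpace ℝ (Fin d)} {b : EuclideanSpace ℝ (Fin d) → EuclideanSpace ℝ (Fin d)}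
  {c : EuclideanSpace ℝ (Fin d) → ℝ} {N M : ℕ} {x : Fin N → EuclideanSpace ℝ (Fin d)}

theorem aestronglyMeasurable_hatFunction (hΩ_open : IsOpen Ω) (hK : IsTriangulation K Ω)
    (v : EuclideanSpace ℝ (Fin d)) :
    AEStronglyMeasurable (hatFunction K v) (volume.restrict Ω) := by
  refine ContinuousOn.aestronglyMeasurable ?_ hΩ_open.measurableSet
  refine (continuousOn_hatFunction hK.finite hK.card_facet v).mono ?_
  rw [hK.space_eq]
  exact subset_closure

theorem norm_hatFunction_le_one : ‖hatFunction K v p‖ ≤ 1 := by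
  rw [Real.norm_of_nonneg hatFunction_nonneg]
  exact hatFunction_le_one

theorem isFiniteMeasure_restrict_of_isBounded (hΩ_bdd : Bornology.IsBounded Ω) :
    IsFiniteMeasure (volume.restrict Ω) :=
  ⟨by simpa using hΩ_bdd.measure_lt_top⟩

theorem gradient_hatFunction_of_notMem (hT : T ∈ K.faces) (hv : v ∉ T)
    (hp : p ∈ interior (convexHull ℝ (T : Set (EuclideanSpace ℝ (Fin d))))) :
    gradient (hatFunction K v) p = 0 := by
  have h : hatFunction K v =ᶠ[𝓝 p] fun _ => 0 := by
    filter_upwards [isOpen_interior.mem_nhds hp] with q hq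
    exact (hatFunction_spec hT (interior_subset hq)).2.1 v hv
  rw [gradient, h.fderiv_eq]
  simp

theorem integrable_inner_gradient (hΩ_bdd : Bornology.IsBounded Ω)
    (hK : IsTriangulation K Ω) (u v : EuclideanSpace ℝ (Fin d)) :
    Integrable (fun p => inner ℝ (gradient (hatFunction K u) p) (gradient (hatFunction K v) p))
      (volume.restrict Ω) := by
  have := isFiniteMeasure_restrict_of_isBounded hΩ_bdd
  obtain ⟨C, hC⟩ := exists_ae_norm_gradient_le hK u
  obtain ⟨C', hC'⟩ := exists_ae_norm_gradient_le hK v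
  refine Integrable.of_bound ((measurable_gradient _).aestronglyMeasurable.inner
    (measurable_gradient _).aestronglyMeasurable) (C * C') ?_
  filter_upwards [hC, hC'] with p h h'
  exact (norm_inner_le_norm _ _).trans
    (mul_le_mul h h' (norm_nonneg _) ((norm_nonneg _).trans h))

theorem integrable_inner_gradient_mul (hΩ_open : IsOpen Ω) (hΩ_bdd : Bornology.IsBounded Ω)
    (hK : IsTriangulation K Ω) (hb : ∀ k : Fin d, MemLp (fun p => b p k) ⊤ (volume.restrict Ω))
    (u v : EuclideanSpace ℝ (Fin d)) :
    Integrable (fun p => inner ℝ (b p) (gradient (hatFunction K u) p) * hatFunction K v p)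
      (volume.restrict Ω) := by
  have := isFiniteMeasure_restrict_of_isBounded hΩ_bdd
  obtain ⟨hb_meas, Cb, hCb⟩ := exists_ae_norm_le_of_memLp_top hb
  obtain ⟨C, hC⟩ := exists_ae_norm_gradient_le hK u
  refine Integrable.of_bound ((hb_meas.inner (measurable_gradient _).aestronglyMeasurable).mul
    (aestronglyMeasurable_hatFunction hΩ_open hK v)) (Cb * C * 1) ?_
  filter_upwards [hCb, hC] with p h h'
  rw [norm_mul]
  have h0 := (norm_nonneg _).trans h
  have h0' := (norm_nonneg _).trans h'
  exact mul_le_mul ((norm_inner_le_norm _ _).trans (mul_le_mul h h' (norm_nonneg _) h0))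
    norm_hatFunction_le_one (norm_nonneg _) (mul_nonneg h0 h0')

/-- The hat functions sum to 1 on the open set `Ω`; differentiate this identity. -/
theorem ae_sum_gradient_hatFunction (hΩ_open : IsOpen Ω) (hK : IsTriangulation K Ω)
    (hx_inj : Function.Injective x) (hx_range : Set.range x = K.vertices) :
    ∀ᵐ p ∂volume.restrict Ω, ∑ i, gradient (hatFunction K (x i)) p = 0 := by
  filter_upwards [ae_differentiableAt_hatFunction hK, ae_restrict_mem hΩ_open.measurableSet]
    with p hp hpΩ
  have h1 : HasFDerivAt (fun q => ∑ i, hatFunction K (x i) q)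
      (∑ i, fderiv ℝ (hatFunction K (x i)) p) p :=
    HasFDerivAt.fun_sum fun i _ => (hp (x i)).hasFDerivAt
  have h2 : (fun q => ∑ i, hatFunction K (x i) q) =ᶠ[𝓝 p] fun _ => 1 := by
    filter_upwards [hΩ_open.mem_nhds hpΩ] with q hq
    exact sum_hatFunction_eq_one hx_inj hx_range (hK.space_eq ▸ subset_closure hq)
  have h3 : ∑ i, fderiv ℝ (hatFunction K (x i)) p = 0 := by
    rw [← h1.fderiv, h2.fderiv_eq]
    simp
  simp only [gradient, ← map_sum, h3, map_zero]

/-- The double sum over an index set of the entries of the convection-diffusion matrix. -/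
theorem sum_sum_convDiffForm (hΩ_open : IsOpen Ω) (hΩ_bdd : Bornology.IsBounded Ω)
    (hK : IsTriangulation K Ω) (hb : ∀ k : Fin d, MemLp (fun p => b p k) ⊤ (volume.restrict Ω))
    (ε : ℝ) (I J : Finset (Fin N)) :
    ∑ i ∈ I, ∑ j ∈ J, convDiffForm Ω ε b (hatFunction K (x j)) (hatFunction K (x i)) =
      ε * (∫ p in Ω, inner ℝ (∑ j ∈ J, gradient (hatFunction K (x j)) p)
        (∑ i ∈ I, gradient (hatFunction K (x i)) p)) +
      ∫ p in Ω, inner ℝ (b p) (∑ j ∈ J, gradient (hatFunction K (x j)) p) *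
        ∑ i ∈ I, hatFunction K (x i) p := by
  simp only [convDiffForm, Finset.sum_add_distrib, ← Finset.mul_sum]
  congr 2
  · simp only [inner_sum, sum_inner]
    rw [integral_finsetSum _ fun i _ => integrable_finsetSum _ fun j _ =>
      integrable_inner_gradient hΩ_bdd hK _ _]
    refine Finset.sum_congr rfl fun i _ => ?_
    rw [integral_finsetSum _ fun j _ => integrable_inner_gradient hΩ_bdd hK _ _]
  · simp only [inner_sum, Finset.sum_mul, Finset.mul_sum]
    rw [integral_finsetSum _ fun i _ => integrable_finsetSum _ fun j _ =>
      integrable_inner_gradient_mul hΩ_open hΩ_bdd hK hb _ _]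
    refine Finset.sum_congr rfl fun i _ => ?_
    rw [integral_finsetSum _ fun j _ => integrable_inner_gradient_mul hΩ_open hΩ_bdd hK hb _ _]

theorem sum_convDiffForm_eq_zero (hΩ_open : IsOpen Ω) (hΩ_bdd : Bornology.IsBounded Ω)
    (hK : IsTriangulation K Ω) (hb : ∀ k : Fin d, MemLp (fun p => b p k) ⊤ (volume.restrict Ω))
    (hx_inj : Function.Injective x) (hx_range : Set.range x = K.vertices) (ε : ℝ) (i : Fin N) :
    ∑ j, convDiffForm Ω ε b (hatFunction K (x j)) (hatFunction K (x i)) = 0 := by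
  have h := sum_sum_convDiffForm (x := x) hΩ_open hΩ_bdd hK hb ε {i} Finset.univ
  have h0 := ae_sum_gradient_hatFunction hΩ_open hK hx_inj hx_range
  rw [Finset.sum_singleton] at h
  rw [h, integral_eq_zero_of_ae, integral_eq_zero_of_ae, mul_zero, add_zero]
  · filter_upwards [h0] with p hp
    simp [hp]
  · filter_upwards [h0] with p hp
    simp [hp]

/-- A cell containing both vertices would contain the edge between them, so on each open cell one of
the two hat functions vanishes together with its gradient. -/
theorem convDiffForm_eq_zero (hK : IsTriangulation K Ω) (ε : ℝ) {i j : Fin N} (hij : j ≠ i)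
    (hj : j ∉ edgeNeighbours K x i) :
    convDiffForm Ω ε b (hatFunction K (x j)) (hatFunction K (x i)) = 0 := by
  rw [convDiffForm, integral_eq_zero_of_ae, integral_eq_zero_of_ae, mul_zero, add_zero]
  · filter_upwards [ae_mem_interior_facet hK] with p ⟨T, hT, hp⟩
    rcases notMem_or_notMem_of_not_edge hT.1 hij hj with h | h
    · simp [(hatFunction_spec hT.1 (interior_subset hp)).2.1 _ h]
    · simp [gradient_hatFunction_of_notMem hT.1 h hp]
  · filter_upwards [ae_mem_interior_facet hK] with p ⟨T, hT, hp⟩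
    rcases notMem_or_notMem_of_not_edge hT.1 hij hj with h | h
    · simp [gradient_hatFunction_of_notMem hT.1 h hp]
    · simp [gradient_hatFunction_of_notMem hT.1 h hp]

theorem interior_facet_subset (hΩ_reg : interior (closure Ω) = Ω) (hK : IsTriangulation K Ω)
    (hT : T ∈ K.faces) : interior (convexHull ℝ (T : Set (EuclideanSpace ℝ (Fin d)))) ⊆ Ω := by
  have h := interior_mono (K.convexHull_subset_space hT)
  rwa [hK.space_eq, hΩ_reg] at h

/-- A nonzero finite element function of the form `∑ i ∈ J, φ_i` that vanishes outside the domain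
cannot have a gradient that vanishes almost everywhere. -/
theorem not_ae_sum_gradient_eq_zero (hd : 1 ≤ d) (hΩ_open : IsOpen Ω)
    (hΩ_bdd : Bornology.IsBounded Ω) (hΩ_reg : interior (closure Ω) = Ω)
    (hK : IsTriangulation K Ω) (hx_inj : Function.Injective x)
    (hx_range : Set.range x = K.vertices) {J : Finset (Fin N)} (hJ : J.Nonempty)
    (hJΩ : ∀ i ∈ J, x i ∈ Ω) :
    ¬ ∀ᵐ p ∂volume.restrict Ω, ∑ i ∈ J, gradient (hatFunction K (x i)) p = 0 := by
  classical
  intro h0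
  set u : EuclideanSpace ℝ (Fin d) → ℝ := fun p => ∑ i ∈ J, hatFunction K (x i) p with hu
  have hvert : ∀ k, u (x k) = if k ∈ J then 1 else 0 := fun k => by
    have hk : x k ∈ K.vertices := hx_range ▸ Set.mem_range_self k
    simp only [hu, hatFunction_vertex hk, hx_inj.eq_iff, Finset.sum_ite_eq']
  have hcell : ∀ T ∈ K.facets, ∀ p ∈ convexHull ℝ (T : Set (EuclideanSpace ℝ (Fin d))),
      u p = 0 ∨ u p = 1 := by
    intro T hT p hp
    have hcard := hK.card_facet T hT
    choose G hG hGaff using fun v => exists_gradient_hatFunction hT.1 hcard v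
    have hne := interior_convexHull_nonempty_of_card hT.1 hcard
    have hsub := interior_facet_subset hΩ_reg hK hT.1
    -- The gradient is constant on the open cell, which has positive measure, so vanishing almost
    -- everywhere means vanishing there.
    have hG0 : ∑ i ∈ J, G (x i) = 0 := by
      have h1 := ae_mono (Measure.restrict_mono hsub le_rfl) h0
      have h2 := ae_restrict_mem (μ := volume)
        (isOpen_interior (s := convexHull ℝ (T : Set (EuclideanSpace ℝ (Fin d))))).measurableSet
      have hNe : (ae (volume.restrict
          (interior (convexHull ℝ (T : Set (EuclideanSpace ℝ (Fin d))))))).NeBot := by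
        rw [ae_neBot, Ne, Measure.restrict_eq_zero]
        exact (isOpen_interior.measure_pos volume hne).ne'
      obtain ⟨q, hq1, hq2⟩ := (Filter.Eventually.and h1 h2).exists
      rw [← hq1]
      exact Finset.sum_congr rfl fun i _ => ((hG (x i) q hq2).gradient).symm
    obtain ⟨y, hy⟩ := SimplicialComplex.nonempty_of_mem_faces hT.1
    have hyv : y ∈ Set.range x := by
      rw [hx_range]
      exact K.down_closed hT.1 (by simpa using hy) (Finset.singleton_nonempty y)
    obtain ⟨k, rfl⟩ := hyv
    have hconst : u p - u (x k) = 0 := by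
      simp only [hu, ← Finset.sum_sub_distrib]
      rw [Finset.sum_congr rfl fun i _ =>
        hGaff (x i) p hp (x k) (subset_convexHull ℝ _ hy), ← sum_inner, hG0, inner_zero_left]
    rw [hvert] at hconst
    split_ifs at hconst
    · right; linarith
    · left; linarith
  have hout : ∀ p, p ∉ Ω → u p = 0 := fun p hp =>
    Finset.sum_eq_zero fun i hi => hatFunction_eq_zero_of_notMem hΩ_reg hK (hJΩ i hi) hp
  have hcont : Continuous u := continuous_finsetSum _ fun i hi => by
    obtain ⟨L, hL⟩ := exists_lipschitzWith_hatFunction hΩ_open hΩ_reg hK (hJΩ i hi)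
    exact hL.continuous
  have hΩ_ne : ∃ q, q ∉ Ω := by
    have : Nonempty (Fin d) := ⟨⟨0, hd⟩⟩
    by_contra! h
    rw [Set.eq_univ_of_forall h] at hΩ_bdd
    exact NormedSpace.unbounded_univ ℝ (EuclideanSpace ℝ (Fin d)) hΩ_bdd
  obtain ⟨q, hq⟩ := hΩ_ne
  obtain ⟨i, hi⟩ := hJ
  -- By connectedness of the whole space `u` takes the value 1/2 between a point outside `Ω` and a
  -- vertex of `J`, although only 0 and 1 are possible.
  obtain ⟨p, hp⟩ := mem_range_of_exists_le_of_exists_ge hcont (c := 1 / 2)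
    ⟨q, by rw [hout q hq]; norm_num⟩ ⟨x i, by rw [hvert, if_pos hi]; norm_num⟩
  by_cases hpΩ : p ∈ Ω
  · obtain ⟨T, hT, hpT⟩ := exists_facet_of_mem_space hK.finite
      (hK.space_eq ▸ subset_closure hpΩ : p ∈ K.space)
    rcases hcell T hT p hpT with h | h <;> · rw [h] at hp; norm_num at hp
  · rw [hout p hpΩ] at hp
    norm_num at hp

/-- The convection-diffusion form is positive on sums of hat functions of interior vertices. -/
theorem sum_sum_convDiffForm_pos (hd : 1 ≤ d) (hΩ_open : IsOpen Ω)
    (hΩ_bdd : Bornology.IsBounded Ω) (hΩ_reg : interior (closure Ω) = Ω)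
    (hK : IsTriangulation K Ω) (hb : ∀ k : Fin d, MemLp (fun p => b p k) ⊤ (volume.restrict Ω))
    (hb_div : IsWeaklyDivFree Ω b) (hx_inj : Function.Injective x)
    (hx_range : Set.range x = K.vertices) {ε : ℝ} (hε : 0 < ε) {J : Finset (Fin N)}
    (hJ : J.Nonempty) (hJΩ : ∀ i ∈ J, x i ∈ Ω) :
    0 < ∑ i ∈ J, ∑ j ∈ J, convDiffForm Ω ε b (hatFunction K (x j)) (hatFunction K (x i)) := by
  rw [sum_sum_convDiffForm hΩ_open hΩ_bdd hK hb]
  set u : EuclideanSpace ℝ (Fin d) → ℝ := fun p => ∑ i ∈ J, hatFunction K (x i) p with hu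
  have hlip : ∃ L : ℝ≥0, LipschitzWith L u := by
    choose! L hL using fun i (hi : i ∈ J) =>
      exists_lipschitzWith_hatFunction hΩ_open hΩ_reg hK (hJΩ i hi)
    refine ⟨∑ i ∈ J, L i, LipschitzWith.of_dist_le_mul fun p q => ?_⟩
    rw [Real.dist_eq, ← Finset.sum_sub_distrib, NNReal.coe_sum, Finset.sum_mul]
    exact (Finset.abs_sum_le_sum_abs _ _).trans
      (Finset.sum_le_sum fun i hi => (hL i hi).dist_le_mul p q)
  obtain ⟨L, hL⟩ := hlip
  obtain ⟨hb_meas, C, hC⟩ := exists_ae_norm_le_of_memLp_top hb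
  have hgrad : ∀ᵐ p ∂volume.restrict Ω,
      gradient u p = ∑ i ∈ J, gradient (hatFunction K (x i)) p := by
    filter_upwards [ae_differentiableAt_hatFunction hK] with p hp
    have h1 : HasFDerivAt u (∑ i ∈ J, fderiv ℝ (hatFunction K (x i)) p) p :=
      HasFDerivAt.fun_sum fun i _ => (hp (x i)).hasFDerivAt
    simp only [gradient, h1.fderiv, map_sum]
  have hconv : ∫ p in Ω, inner ℝ (b p) (∑ j ∈ J, gradient (hatFunction K (x j)) p) *
      ∑ i ∈ J, hatFunction K (x i) p = 0 := by
    rw [← integral_inner_gradient_mul_self_eq_zero hΩ_open hΩ_bdd hb_meas hC hb_div hL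
      (R := ∑ i ∈ J, 1) (fun p => Finset.sum_nonneg fun i _ => hatFunction_nonneg)
      (fun p => Finset.sum_le_sum fun i _ => hatFunction_le_one)
      (fun p hp => Finset.sum_eq_zero fun i hi =>
        hatFunction_eq_zero_of_notMem hΩ_reg hK (hJΩ i hi) hp)]
    refine integral_congr_ae ?_
    filter_upwards [hgrad] with p hp
    rw [hp]
  rw [hconv, add_zero]
  refine mul_pos hε (lt_of_le_of_ne (integral_nonneg fun p => real_inner_self_nonneg) fun h => ?_)
  refine not_ae_sum_gradient_eq_zero hd hΩ_open hΩ_bdd hΩ_reg hK hx_inj hx_range hJ hJΩ ?_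
  have hint : Integrable (fun p => inner ℝ (∑ j ∈ J, gradient (hatFunction K (x j)) p)
      (∑ i ∈ J, gradient (hatFunction K (x i)) p)) (volume.restrict Ω) := by
    simp only [inner_sum, sum_inner]
    exact integrable_finsetSum _ fun i _ => integrable_finsetSum _ fun j _ =>
      integrable_inner_gradient hΩ_bdd hK _ _
  have h0 := (integral_eq_zero_iff_of_nonneg (fun p => real_inner_self_nonneg) hint).1 h.symm
  filter_upwards [h0] with p hp
  exact inner_self_eq_zero.1 hp

theorem sum_integral_mul_hatFunction (hΩ_open : IsOpen Ω) (hΩ_bdd : Bornology.IsBounded Ω)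
    (hK : IsTriangulation K Ω) (hc : MemLp c ⊤ (volume.restrict Ω))
    (hx_inj : Function.Injective x) (hx_range : Set.range x = K.vertices) (i : Fin N) :
    ∑ j, ∫ p in Ω, c p * hatFunction K (x j) p * hatFunction K (x i) p =
      ∫ p in Ω, c p * hatFunction K (x i) p := by
  have := isFiniteMeasure_restrict_of_isBounded hΩ_bdd
  have hint : Integrable c (volume.restrict Ω) := hc.integrable le_top
  have hm := aestronglyMeasurable_hatFunction hΩ_open hK
  rw [← integral_finsetSum _ fun j _ =>
    ((hint.mul_bdd (c := 1) (hm (x j)) (ae_of_all _ fun p => norm_hatFunction_le_one)).mul_bdd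
      (c := 1) (hm (x i)) (ae_of_all _ fun p => norm_hatFunction_le_one))]
  refine setIntegral_congr_fun hΩ_open.measurableSet fun p hp => ?_
  rw [← Finset.sum_mul, ← Finset.mul_sum,
    sum_hatFunction_eq_one hx_inj hx_range (hK.space_eq ▸ subset_closure hp), mul_one]

/-- Both discrete forms split into the convection-diffusion form and a nonnegative reaction
matrix with row sums `(c, φ_i)`. -/
theorem exists_reaction_matrix (hΩ_open : IsOpen Ω) (hΩ_bdd : Bornology.IsBounded Ω)
    (hK : IsTriangulation K Ω) (hc : MemLp c ⊤ (volume.restrict Ω))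
    (hc0 : ∀ᵐ p ∂volume.restrict Ω, 0 ≤ c p) (hx_inj : Function.Injective x)
    (hx_range : Set.range x = K.vertices) {ε : ℝ}
    {a_h : (EuclideanSpace ℝ (Fin d) → ℝ) → (EuclideanSpace ℝ (Fin d) → ℝ) → ℝ}
    (ha_h : a_h = galerkinForm Ω ε b c ∨ a_h = lumpedForm Ω ε b c K x M) :
    ∃ R : Matrix (Fin N) (Fin N) ℝ,
      (∀ i j, femMatrix K x a_h i j =
        convDiffForm Ω ε b (hatFunction K (x j)) (hatFunction K (x i)) + R i j) ∧
      (∀ i j, 0 ≤ R i j) ∧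
      (∀ i : Fin N, i.val < M → ∑ j, R i j = ∫ p in Ω, c p * hatFunction K (x i) p) ∧
      ∀ i j, j ≠ i → j ∉ edgeNeighbours K x i → R i j = 0 := by
  classical
  rcases ha_h with rfl | rfl
  · refine ⟨Matrix.of fun i j => ∫ p in Ω, c p * hatFunction K (x j) p * hatFunction K (x i) p,
      fun i j => rfl, fun i j => ?_, fun i _ =>
        sum_integral_mul_hatFunction hΩ_open hΩ_bdd hK hc hx_inj hx_range i,
      fun i j hij hj => ?_⟩
    · refine integral_nonneg_of_ae ?_
      filter_upwards [hc0] with p hp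
      exact mul_nonneg (mul_nonneg hp hatFunction_nonneg) hatFunction_nonneg
    · refine integral_eq_zero_of_ae ?_
      filter_upwards [ae_mem_interior_facet hK] with p ⟨T, hT, hp⟩
      have h0 := (hatFunction_spec hT.1 (interior_subset hp)).2.1
      rcases notMem_or_notMem_of_not_edge hT.1 hij hj with h | h <;> simp [h0 _ h]
  · have hvert : ∀ i k, hatFunction K (x i) (x k) = if i = k then 1 else 0 := fun i k => by
      rw [hatFunction_vertex (hx_range ▸ Set.mem_range_self k : x k ∈ K.vertices)]
      simp only [hx_inj.eq_iff]
    -- The lumped reaction matrix is diagonal and its boundary rows are zero, which is why the row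
    -- sums are claimed only for `i.val < M`.
    refine ⟨Matrix.of fun i j => ∑ k : Fin N with k.val < M,
      (∫ p in Ω, c p * hatFunction K (x k) p) * hatFunction K (x j) (x k) *
        hatFunction K (x i) (x k), fun i j => rfl, fun i j => ?_, fun i hi => ?_,
      fun i j hij _ => ?_⟩
    · rw [Matrix.of_apply]
      refine Finset.sum_nonneg fun k _ => mul_nonneg (mul_nonneg ?_ hatFunction_nonneg)
        hatFunction_nonneg
      refine integral_nonneg_of_ae ?_
      filter_upwards [hc0] with p hp
      exact mul_nonneg hp hatFunction_nonneg
    · simp only [Matrix.of_apply, hvert, mul_ite, mul_one, mul_zero]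
      simp [Finset.sum_ite_eq, hi]
    · rw [Matrix.of_apply]
      refine Finset.sum_eq_zero fun k _ => ?_
      rw [hvert, hvert]
      by_cases hjk : j = k
      · rw [if_neg (fun h => hij (hjk.trans h.symm) : ¬ i = k), mul_zero]
      · rw [if_neg hjk, mul_zero, zero_mul]

end DiscreteForms

/-! ### The algebraic contradiction at a maximum -/

section Algebraic

open Filter Topology

variable {N M : ℕ} {S : Fin N → Set (Fin N)} {A : Matrix (Fin N) (Fin N) ℝ}
  {B : (Fin N → ℝ) → Matrix (Fin N) (Fin N) ℝ}

/-- At a not necessarily strict local maximum, assumption (A2) survives in the form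
`(a_ij + b_ij(U)) (u_j - u_i) ≥ 0`. -/
theorem add_mul_sub_nonneg_of_local_max (hA1 : AssumptionA1 M B) (hA2 : AssumptionA2 M S A B)
    (hS : ∀ i, i ∉ S i) {U : Fin N → ℝ} {i : Fin N} (hi : i.val < M)
    (hmax : ∀ j ∈ S i, U j ≤ U i) {j : Fin N} (hj : j ∈ S i) :
    0 ≤ (A i j + B U i j) * (U j - U i) := by
  set f : (Fin N → ℝ) → ℝ := fun V => A i j * (V j - V i) + B V i j * (V j - V i) with hf
  have hfc : Continuous f :=
    (continuous_const.mul ((continuous_apply j).sub (continuous_apply i))).add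
      (hA1.continuous i j hi)
  -- Raising the single value `U i` by `t > 0` makes the maximum strict, so (A2) applies; then `t`
  -- tends to 0.
  have hup : Continuous fun t : ℝ => Function.update U i (U i + t) :=
    continuous_const.update i (continuous_const.add continuous_id)
  have ht : Tendsto (fun t : ℝ => f (Function.update U i (U i + t))) (𝓝[>] 0) (𝓝 (f U)) := by
    have h := ((hfc.comp hup).tendsto 0).mono_left (nhdsWithin_le_nhds (s := Set.Ioi 0))
    simp only [Function.comp_apply, add_zero, Function.update_eq_self] at h
    exact h
  have hnn : 0 ≤ f U := by
    refine ge_of_tendsto ht ?_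
    filter_upwards [self_mem_nhdsWithin] with t ht
    have ht0 : 0 < t := ht
    set V := Function.update U i (U i + t) with hV
    have hlt : ∀ k ∈ S i, V k < V i := fun k hk => by
      have hki : k ≠ i := fun h => hS i (h ▸ hk)
      simp only [hV, Function.update_of_ne hki, Function.update_self]
      linarith [hmax k hk]
    have h1 := hA2 V i hi (Or.inl hlt) j hj
    have h2 := hlt j hj
    simp only [hf, ← add_mul]
    exact mul_nonneg_of_nonpos_of_nonpos h1 (by linarith)
  simpa only [hf, ← add_mul] using hnn

/-- A discrete solution cannot attain its maximum exactly on a set of interior indices. -/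
theorem not_maximum_on_interior_indices (hB : IsArtificialDiffusion M S B)
    (hA1 : AssumptionA1 M B) (hA2 : AssumptionA2 M S A B) (hS : ∀ i, i ∉ S i)
    (hA_off : ∀ i j : Fin N, j ≠ i → j ∉ S i → A i j = 0) {r : Fin N → ℝ} (hr : ∀ i, 0 ≤ r i)
    (hrow : ∀ i : Fin N, i.val < M → ∑ j, A i j = r i)
    {G U : Fin N → ℝ} (hU : SolvesStabilized M A B G U) {J : Finset (Fin N)}
    (hpos : 0 < ∑ i ∈ J, ∑ j ∈ J, A i j)
    {s : ℝ} (hJM : ∀ i ∈ J, i.val < M) (hJs : ∀ i ∈ J, U i = s)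
    (hlt : ∀ i ∈ J, ∀ j ∈ S i, j ∉ J → U j < s) (hG : ∀ i ∈ J, G i ≤ 0)
    (hs : (∀ i ∈ J, r i = 0) ∨ 0 < s) : False := by
  classical
  have hsum : ∀ i ∈ J, ∑ j, (A i j + B U i j) = r i := fun i hi => by
    rw [Finset.sum_add_distrib, hrow i (hJM i hi), hB.row_sum, add_zero]
  have hoff : ∀ i ∈ J, ∀ j, j ≠ i → j ∉ S i → A i j + B U i j = 0 := fun i hi j hij hj => by
    rw [hA_off i j hij hj, hB.local_support U i j (hJM i hi) hj hij, add_zero]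
  have hterm : ∀ i ∈ J, ∀ j, 0 ≤ (A i j + B U i j) * (U j - s) := fun i hi j => by
    by_cases hij : j = i
    · rw [hij, hJs i hi, sub_self, mul_zero]
    by_cases hj : j ∈ S i
    · rw [← hJs i hi]
      refine add_mul_sub_nonneg_of_local_max hA1 hA2 hS (hJM i hi) (fun k hk => ?_) hj
      rw [hJs i hi]
      by_cases hkJ : k ∈ J
      · exact (hJs k hkJ).le
      · exact (hlt i hi k hk hkJ).le
    · rw [hoff i hi j hij hj, zero_mul]
  -- Subtracting the constant `s` from `U` costs `s` times the row sum, to which `B` does not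
  -- contribute.
  have heq : ∀ i ∈ J, ∑ j, (A i j + B U i j) * (U j - s) + r i * s = G i := fun i hi => by
    rw [← hU i (hJM i hi), ← hsum i hi, Finset.sum_mul, ← Finset.sum_add_distrib]
    exact Finset.sum_congr rfl fun j _ => by ring
  have hr0 : ∀ i ∈ J, r i = 0 := fun i hi => by
    rcases hs with h | h
    · exact h i hi
    · have h1 := Finset.sum_nonneg fun j (_ : j ∈ Finset.univ) => hterm i hi j
      have h2 : r i * s ≤ 0 := by linarith [heq i hi, hG i hi]
      exact le_antisymm (nonpos_of_mul_nonpos_left h2 h) (hr i)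
  -- A vanishing sum of nonnegative terms, with `U j < s` for neighbours outside `J`, decouples `J`
  -- from all other indices.
  have hzero : ∀ i ∈ J, ∀ j, j ∉ J → A i j + B U i j = 0 := fun i hi j hj => by
    have hij : j ≠ i := fun h => hj (h ▸ hi)
    by_cases hjS : j ∈ S i
    · have h1 := heq i hi
      rw [hr0 i hi, zero_mul, add_zero] at h1
      have h2 : ∑ j, (A i j + B U i j) * (U j - s) = 0 :=
        le_antisymm (h1.trans_le (hG i hi)) (Finset.sum_nonneg fun j _ => hterm i hi j)
      have h3 := (Finset.sum_eq_zero_iff_of_nonneg fun j _ => hterm i hi j).1 h2 j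
        (Finset.mem_univ j)
      exact (mul_eq_zero.1 h3).resolve_right (sub_ne_zero.2 (hlt i hi j hjS hj).ne)
    · exact hoff i hi j hij hjS
  have hJJ : ∑ i ∈ J, ∑ j ∈ J, (A i j + B U i j) = 0 := Finset.sum_eq_zero fun i hi => by
    rw [Finset.sum_subset (Finset.subset_univ J) fun j _ hj => hzero i hi j hj, hsum i hi,
      hr0 i hi]
  -- Row sums of `B` are zero and entries leaving `J` are nonpositive, so each row restricted to `J`
  -- has nonnegative sum. The positive sum of `A` over `J × J` is then incompatible with `hJJ`.
  have hBJ : 0 ≤ ∑ i ∈ J, ∑ j ∈ J, B U i j := Finset.sum_nonneg fun i hi => by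
    have h1 := Finset.sum_add_sum_compl J fun j => B U i j
    rw [hB.row_sum] at h1
    have h2 : ∑ j ∈ Jᶜ, B U i j ≤ 0 := Finset.sum_nonpos fun j hj =>
      hB.nonpos U i j fun h => Finset.mem_compl.1 hj (h ▸ hi)
    linarith
  simp only [Finset.sum_add_distrib] at hJJ
  linarith

/-- The structure of `B` survives the reflection `U ↦ -U`; with the analogues for (A1), (A2) and the
equations below, this reduces minima to maxima. -/
theorem IsArtificialDiffusion.comp_neg (hB : IsArtificialDiffusion M S B) :
    IsArtificialDiffusion M S fun U => B (-U) :=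
  ⟨fun U => hB.symm (-U), fun U => hB.nonpos (-U), fun U => hB.row_sum (-U),
    fun U => hB.local_support (-U)⟩

theorem AssumptionA1.comp_neg (hA1 : AssumptionA1 M B) : AssumptionA1 M fun U => B (-U) := by
  refine ⟨fun i j hi => ?_, fun i j hi hj => ?_⟩
  · have h := ((hA1.continuous i j hi).comp continuous_neg).neg
    refine h.congr fun U => ?_
    simp only [Function.comp_apply, Pi.neg_apply]
    ring
  · obtain ⟨C, hC⟩ := hA1.bounded i j hi hj
    exact ⟨C, fun U => hC (-U)⟩

theorem AssumptionA2.comp_neg (hA2 : AssumptionA2 M S A B) :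
    AssumptionA2 M S A fun U => B (-U) := by
  intro U i hi h
  refine hA2 (-U) i hi ?_
  rcases h with h | h
  · exact Or.inr fun j hj => neg_lt_neg (h j hj)
  · exact Or.inl fun j hj => neg_lt_neg (h j hj)

theorem SolvesStabilized.neg {G U : Fin N → ℝ} (hU : SolvesStabilized M A B G U) :
    SolvesStabilized M A (fun U => B (-U)) (-G) (-U) := by
  intro i hi
  simp only [neg_neg, Pi.neg_apply, mul_neg, Finset.sum_neg_distrib, hU i hi]

end Algebraic

/-! ### The maximum principle on a union of cells -/

section MaximumPrinciple

variable {d : ℕ} {K : SimplicialComplex ℝ (EuclideanSpace ℝ (Fin d))}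
  {Ω : Set (EuclideanSpace ℝ (Fin d))} {N M : ℕ} {x : Fin N → EuclideanSpace ℝ (Fin d)}
  {𝒢 : Set (Finset (EuclideanSpace ℝ (Fin d)))} {A : Matrix (Fin N) (Fin N) ℝ}
  {B : (Fin N → ℝ) → Matrix (Fin N) (Fin N) ℝ}

theorem isCompact_simplexUnion (hK : IsTriangulation K Ω) (h𝒢 : 𝒢 ⊆ K.facets) :
    IsCompact (simplexUnion 𝒢) :=
  (hK.finite.subset (h𝒢.trans K.facets_subset)).isCompact_biUnion fun _ _ =>
    isCompact_convexHull_finset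

theorem simplexUnion_subset_closure (hK : IsTriangulation K Ω) (h𝒢 : 𝒢 ⊆ K.facets) :
    simplexUnion 𝒢 ⊆ closure Ω := by
  rw [← hK.space_eq]
  exact Set.iUnion₂_subset fun T hT => K.convexHull_subset_space (h𝒢 hT).1

theorem simplexUnion_nonempty (h𝒢 : 𝒢 ⊆ K.facets) (h𝒢_ne : 𝒢.Nonempty) :
    (simplexUnion 𝒢).Nonempty := by
  obtain ⟨T, hT⟩ := h𝒢_ne
  obtain ⟨y, hy⟩ := SimplicialComplex.nonempty_of_mem_faces (h𝒢 hT).1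
  exact ⟨y, Set.mem_iUnion₂.2 ⟨T, hT, subset_convexHull ℝ _ hy⟩⟩

theorem IsCompact.frontier_nonempty (hd : 1 ≤ d) {s : Set (EuclideanSpace ℝ (Fin d))}
    (hs : IsCompact s) (hne : s.Nonempty) : (frontier s).Nonempty := by
  have : Nonempty (Fin d) := ⟨⟨0, hd⟩⟩
  rw [nonempty_frontier_iff]
  refine ⟨hne, fun h => ?_⟩
  rw [h] at hs
  exact NormedSpace.unbounded_univ ℝ (EuclideanSpace ℝ (Fin d)) hs.isBounded

theorem continuousOn_feFunction (hK : IsTriangulation K Ω) (U : Fin N → ℝ) :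
    ContinuousOn (feFunction K x U) (closure Ω) := by
  rw [← hK.space_eq]
  exact continuousOn_finsetSum _ fun i _ =>
    continuousOn_const.mul (continuousOn_hatFunction hK.finite hK.card_facet (x i))

theorem feFunction_vertex (hx_inj : Function.Injective x) (hx_range : Set.range x = K.vertices)
    (U : Fin N → ℝ) (k : Fin N) : feFunction K x U (x k) = U k := by
  classical
  have hk : x k ∈ K.vertices := hx_range ▸ Set.mem_range_self k
  simp [feFunction, hatFunction_vertex hk, hx_inj.eq_iff]

theorem feFunction_neg (U : Fin N → ℝ) (p : EuclideanSpace ℝ (Fin d)) :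
    feFunction K x (-U) p = -feFunction K x U p := by
  simp [feFunction]

/-- A finite element function attains its maximum over a union of cells at a vertex. -/
theorem exists_vertex_eq_maximum (hx_inj : Function.Injective x)
    (hx_range : Set.range x = K.vertices) (h𝒢 : 𝒢 ⊆ K.facets) {U : Fin N → ℝ} {m : ℝ}
    (hm : IsGreatest (feFunction K x U '' simplexUnion 𝒢) m) :
    ∃ i, x i ∈ simplexUnion 𝒢 ∧ U i = m := by
  obtain ⟨⟨p, hp, hpm⟩, hub⟩ := hm
  obtain ⟨T, hT, hpT⟩ := Set.mem_iUnion₂.1 hp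
  obtain ⟨I, hI, hsum, h1⟩ := sum_hatFunction hx_inj hx_range (h𝒢 hT).1 hpT U
  have hIG : ∀ i ∈ I, x i ∈ simplexUnion 𝒢 := fun i hi =>
    Set.mem_iUnion₂.2 ⟨T, hT, subset_convexHull ℝ _ ((hI i).1 hi)⟩
  have hle : ∀ i ∈ I, U i ≤ m := fun i hi =>
    hub ⟨x i, hIG i hi, feFunction_vertex hx_inj hx_range U i⟩
  -- The value at `p` is a convex combination of vertex values not exceeding `m`. As it equals `m`,
  -- every vertex with nonzero weight has value `m`.
  have hzero : ∑ i ∈ I, (m - U i) * hatFunction K (x i) p = 0 := by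
    simp only [sub_mul, Finset.sum_sub_distrib]
    rw [← Finset.mul_sum, h1, ← hsum, mul_one, ← hpm]
    exact sub_self _
  have hterms := (Finset.sum_eq_zero_iff_of_nonneg fun i hi =>
    mul_nonneg (sub_nonneg.2 (hle i hi)) hatFunction_nonneg).1 hzero
  obtain ⟨i, hi, hne⟩ : ∃ i ∈ I, hatFunction K (x i) p ≠ 0 :=
    Finset.exists_ne_zero_of_sum_ne_zero (by rw [h1]; exact one_ne_zero)
  have := (mul_eq_zero.1 (hterms i hi)).resolve_right hne
  exact ⟨i, hIG i hi, by linarith⟩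

theorem discrete_maximum_principle (hd : 1 ≤ d) (hΩ_reg : interior (closure Ω) = Ω)
    (hK : IsTriangulation K Ω) (hx_inj : Function.Injective x)
    (hx_range : Set.range x = K.vertices) (hx_int : ∀ i : Fin N, i.val < M ↔ x i ∈ Ω)
    (hB : IsArtificialDiffusion M (edgeNeighbours K x) B) (hA1 : AssumptionA1 M B)
    (hA2 : AssumptionA2 M (edgeNeighbours K x) A B)
    (hA_off : ∀ i j : Fin N, j ≠ i → j ∉ edgeNeighbours K x i → A i j = 0)
    {r : Fin N → ℝ} (hr : ∀ i, 0 ≤ r i) (hrow : ∀ i : Fin N, i.val < M → ∑ j, A i j = r i)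
    (hpos : ∀ J : Finset (Fin N), J.Nonempty → (∀ i ∈ J, x i ∈ Ω) → 0 < ∑ i ∈ J, ∑ j ∈ J, A i j)
    (h𝒢 : 𝒢 ⊆ K.facets) (h𝒢_ne : 𝒢.Nonempty) {G U : Fin N → ℝ}
    (hU : SolvesStabilized M A B G U) (hG : ∀ i, x i ∈ interior (simplexUnion 𝒢) → G i ≤ 0) :
    ∃ m m' : ℝ, IsGreatest (feFunction K x U '' simplexUnion 𝒢) m ∧
      IsGreatest (feFunction K x U '' frontier (simplexUnion 𝒢)) m' ∧ m ≤ max m' 0 ∧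
      ((∀ i, x i ∈ interior (simplexUnion 𝒢) → r i = 0) → m = m') := by
  classical
  have hcpt := isCompact_simplexUnion hK h𝒢
  have hne := simplexUnion_nonempty h𝒢 h𝒢_ne
  have hsub := simplexUnion_subset_closure hK h𝒢
  have hfr : frontier (simplexUnion 𝒢) ⊆ simplexUnion 𝒢 := hcpt.isClosed.frontier_subset
  have hcont := (continuousOn_feFunction (x := x) hK U).mono hsub
  obtain ⟨m, hm⟩ := (hcpt.image_of_continuousOn hcont).exists_isGreatest (hne.image _)
  obtain ⟨m', hm'⟩ := ((hcpt.of_isClosed_subset isClosed_frontier hfr).image_of_continuousOn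
    (hcont.mono hfr)).exists_isGreatest ((hcpt.frontier_nonempty hd hne).image _)
  have key : ((∀ i, x i ∈ interior (simplexUnion 𝒢) → r i = 0) ∨ 0 < m) → m ≤ m' := by
    intro hrm
    by_contra! hlt
    -- A vertex of `J` on the frontier would give `m ≤ m'`, so all of `J` is interior to the union,
    -- and therefore to `closure Ω`.
    set J : Finset (Fin N) := Finset.univ.filter fun i => x i ∈ simplexUnion 𝒢 ∧ U i = m with hJ
    have hmem : ∀ i, i ∈ J ↔ x i ∈ simplexUnion 𝒢 ∧ U i = m := fun i => by simp [hJ]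
    have hint : ∀ i ∈ J, x i ∈ interior (simplexUnion 𝒢) := fun i hi => by
      obtain ⟨h1, h2⟩ := (hmem i).1 hi
      by_contra h
      have h3 : U i ≤ m' :=
        hm'.2 ⟨x i, ⟨subset_closure h1, h⟩, feFunction_vertex hx_inj hx_range U i⟩
      linarith
    have hJΩ : ∀ i ∈ J, x i ∈ Ω := fun i hi => hΩ_reg ▸ interior_mono hsub (hint i hi)
    obtain ⟨i₀, hi₀⟩ := exists_vertex_eq_maximum hx_inj hx_range h𝒢 hm
    refine not_maximum_on_interior_indices hB hA1 hA2 (fun i hi => hi.1 rfl) hA_off hr hrow hU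
      (hpos J ⟨i₀, (hmem i₀).2 hi₀⟩ hJΩ) (fun i hi => (hx_int i).2 (hJΩ i hi))
      (fun i hi => ((hmem i).1 hi).2) (fun i hi j hj hjJ => ?_) (fun i hi => hG i (hint i hi))
      (hrm.imp_left fun h i hi => h i (hint i hi))
    have hjG := edgeNeighbours_mem_simplexUnion hK h𝒢 (hint i hi) hj
    refine lt_of_le_of_ne (hm.2 ⟨x j, hjG, feFunction_vertex hx_inj hx_range U j⟩) fun h => ?_
    exact hjJ ((hmem j).2 ⟨hjG, h⟩)
  refine ⟨m, m', hm, hm', ?_, fun h => le_antisymm (key (Or.inl h)) ?_⟩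
  · rcases le_or_gt m 0 with h | h
    · exact h.trans (le_max_right _ _)
    · exact (key (Or.inr h)).trans (le_max_left _ _)
  · obtain ⟨p, hp, hpm⟩ := hm'.1
    exact hm.2 ⟨p, hfr hp, hpm⟩

theorem discrete_minimum_principle (hd : 1 ≤ d) (hΩ_reg : interior (closure Ω) = Ω)
    (hK : IsTriangulation K Ω) (hx_inj : Function.Injective x)
    (hx_range : Set.range x = K.vertices) (hx_int : ∀ i : Fin N, i.val < M ↔ x i ∈ Ω)
    (hB : IsArtificialDiffusion M (edgeNeighbours K x) B) (hA1 : AssumptionA1 M B)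
    (hA2 : AssumptionA2 M (edgeNeighbours K x) A B)
    (hA_off : ∀ i j : Fin N, j ≠ i → j ∉ edgeNeighbours K x i → A i j = 0)
    {r : Fin N → ℝ} (hr : ∀ i, 0 ≤ r i) (hrow : ∀ i : Fin N, i.val < M → ∑ j, A i j = r i)
    (hpos : ∀ J : Finset (Fin N), J.Nonempty → (∀ i ∈ J, x i ∈ Ω) → 0 < ∑ i ∈ J, ∑ j ∈ J, A i j)
    (h𝒢 : 𝒢 ⊆ K.facets) (h𝒢_ne : 𝒢.Nonempty) {G U : Fin N → ℝ}
    (hU : SolvesStabilized M A B G U) (hG : ∀ i, x i ∈ interior (simplexUnion 𝒢) → 0 ≤ G i) :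
    ∃ m m' : ℝ, IsLeast (feFunction K x U '' simplexUnion 𝒢) m ∧
      IsLeast (feFunction K x U '' frontier (simplexUnion 𝒢)) m' ∧ min m' 0 ≤ m ∧
      ((∀ i, x i ∈ interior (simplexUnion 𝒢) → r i = 0) → m = m') := by
  have hleast : ∀ {s : Set (EuclideanSpace ℝ (Fin d))} {m : ℝ},
      IsGreatest (feFunction K x (-U) '' s) m → IsLeast (feFunction K x U '' s) (-m) := by
    rintro s m ⟨⟨p, hp, hpm⟩, hub⟩
    refine ⟨⟨p, hp, by rw [← hpm, feFunction_neg, neg_neg]⟩, ?_⟩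
    rintro _ ⟨q, hq, rfl⟩
    have := hub ⟨q, hq, rfl⟩
    rw [feFunction_neg] at this
    linarith
  obtain ⟨m, m', hm, hm', hle, heq⟩ := discrete_maximum_principle hd hΩ_reg hK hx_inj hx_range
    hx_int hB.comp_neg hA1.comp_neg hA2.comp_neg hA_off hr hrow hpos h𝒢 h𝒢_ne hU.neg
    fun i hi => neg_nonpos.2 (hG i hi)
  refine ⟨-m, -m', hleast hm, hleast hm', ?_, fun h => by rw [heq h]⟩
  have h := neg_le_neg hle
  rwa [← min_neg_neg, neg_zero] at h

/-- The predicate `P` stands for `≤ 0`, `≥ 0` or `= 0`. It transfers from `f` on the union of cells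
to `f φ_v` on all of `Ω`, since `φ_v` vanishes off the union. -/
theorem ae_mul_hatFunction_of_ae (hK : IsTriangulation K Ω) (h𝒢 : 𝒢 ⊆ K.facets)
    {f : EuclideanSpace ℝ (Fin d) → ℝ} {v : EuclideanSpace ℝ (Fin d)}
    (hv : v ∈ interior (simplexUnion 𝒢)) {P : ℝ → Prop} (h0 : P 0)
    (hP : ∀ s t, 0 ≤ t → P s → P (s * t))
    (hf : ∀ᵐ p ∂volume.restrict (simplexUnion 𝒢), P (f p)) :
    ∀ᵐ p ∂volume.restrict Ω, P (f p * hatFunction K v p) := by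
  rw [ae_restrict_iff' (isCompact_simplexUnion hK h𝒢).isClosed.measurableSet] at hf
  filter_upwards [ae_restrict_of_ae hf] with p hp
  by_cases h : hatFunction K v p = 0
  · rwa [h, mul_zero]
  · exact hP _ _ hatFunction_nonneg
      (hp (mem_simplexUnion_of_hatFunction_ne_zero hK h𝒢 hv h))

end MaximumPrinciple

/-! ### The maximum principle for the discrete convection-diffusion-reaction problem -/

theorem theorem4 {d : ℕ} (hd : 1 ≤ d)
    -- the domain: bounded, and equal to the interior of its closure (as for a Lipschitz boundary)
    (Ω : Set (EuclideanSpace ℝ (Fin d))) (hΩ_open : IsOpen Ω) (hΩ_conn : IsConnected Ω)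
    (hΩ_bdd : Bornology.IsBounded Ω) (hΩ_reg : interior (closure Ω) = Ω)
    -- the data of the convection-diffusion-reaction problem
    (ε : ℝ) (hε : 0 < ε)
    (b : EuclideanSpace ℝ (Fin d) → EuclideanSpace ℝ (Fin d))
    (hb : ∀ k : Fin d, MemW1Infty Ω fun p => b p k) (hb_div : IsWeaklyDivFree Ω b)
    (c : EuclideanSpace ℝ (Fin d) → ℝ) (hc : MemLp c ⊤ (volume.restrict Ω))
    (σ₀ : ℝ) (hσ₀ : 0 ≤ σ₀) (hcσ₀ : ∀ᵐ p ∂volume.restrict Ω, σ₀ ≤ c p)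
    (g : EuclideanSpace ℝ (Fin d) → ℝ) (hg : MemLp g 2 (volume.restrict Ω))
    -- the triangulation, its vertices numbered so that exactly the first `M` lie in `Ω`
    (K : SimplicialComplex ℝ (EuclideanSpace ℝ (Fin d))) (hK : IsTriangulation K Ω)
    {N M : ℕ} (x : Fin N → EuclideanSpace ℝ (Fin d)) (hx_inj : Function.Injective x)
    (hx_range : Set.range x = K.vertices) (hx_int : ∀ i : Fin N, i.val < M ↔ x i ∈ Ω)
    -- the discrete bilinear form, without or with lumping of the reaction term
    (a_h : (EuclideanSpace ℝ (Fin d) → ℝ) → (EuclideanSpace ℝ (Fin d) → ℝ) → ℝ)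
    (ha_h : a_h = galerkinForm Ω ε b c ∨ a_h = lumpedForm Ω ε b c K x M)
    -- the artificial diffusion matrix
    (B : (Fin N → ℝ) → Matrix (Fin N) (Fin N) ℝ)
    (hB : IsArtificialDiffusion M (edgeNeighbours K x) B)
    (hA1 : AssumptionA1 M B)
    (hA2 : AssumptionA2 M (edgeNeighbours K x) (femMatrix K x a_h) B)
    -- a nonempty set of mesh cells
    (𝒢 : Set (Finset (EuclideanSpace ℝ (Fin d)))) (h𝒢 : 𝒢 ⊆ K.facets) (h𝒢_ne : 𝒢.Nonempty)
    -- a discrete solution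
    (U : Fin N → ℝ) (hU : SolvesStabilized M (femMatrix K x a_h) B (femLoad Ω K x g) U) :
    ((∀ᵐ p ∂volume.restrict (simplexUnion 𝒢), g p ≤ 0) →
      ∃ m m' : ℝ, IsGreatest (feFunction K x U '' simplexUnion 𝒢) m ∧
        IsGreatest ((fun p => max (feFunction K x U p) 0) '' frontier (simplexUnion 𝒢)) m' ∧
        m ≤ m') ∧
    ((∀ᵐ p ∂volume.restrict (simplexUnion 𝒢), 0 ≤ g p) →
      ∃ m m' : ℝ, IsLeast (feFunction K x U '' simplexUnion 𝒢) m ∧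
        IsLeast ((fun p => min (feFunction K x U p) 0) '' frontier (simplexUnion 𝒢)) m' ∧
        m' ≤ m) ∧
    ((∀ᵐ p ∂volume.restrict (simplexUnion 𝒢), c p = 0) →
      ((∀ᵐ p ∂volume.restrict (simplexUnion 𝒢), g p ≤ 0) →
        ∃ m : ℝ, IsGreatest (feFunction K x U '' simplexUnion 𝒢) m ∧
          IsGreatest (feFunction K x U '' frontier (simplexUnion 𝒢)) m) ∧
      ((∀ᵐ p ∂volume.restrict (simplexUnion 𝒢), 0 ≤ g p) →
        ∃ m : ℝ, IsLeast (feFunction K x U '' simplexUnion 𝒢) m ∧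
          IsLeast (feFunction K x U '' frontier (simplexUnion 𝒢)) m)) := by
  have hbL : ∀ k : Fin d, MemLp (fun p => b p k) ⊤ (volume.restrict Ω) := fun k => (hb k).1
  have hc0 : ∀ᵐ p ∂volume.restrict Ω, 0 ≤ c p := hcσ₀.mono fun p hp => hσ₀.trans hp
  obtain ⟨R, hAR, hR0, hRsum, hRoff⟩ :=
    exists_reaction_matrix hΩ_open hΩ_bdd hK hc hc0 hx_inj hx_range ha_h
  have hA_off : ∀ i j : Fin N, j ≠ i → j ∉ edgeNeighbours K x i → femMatrix K x a_h i j = 0 :=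
    fun i j hij hj => by rw [hAR, convDiffForm_eq_zero hK ε hij hj, hRoff i j hij hj, add_zero]
  have hr : ∀ i, 0 ≤ ∫ p in Ω, c p * hatFunction K (x i) p := fun i => by
    refine integral_nonneg_of_ae ?_
    filter_upwards [hc0] with p hp
    exact mul_nonneg hp hatFunction_nonneg
  have hrow : ∀ i : Fin N, i.val < M →
      ∑ j, femMatrix K x a_h i j = ∫ p in Ω, c p * hatFunction K (x i) p := fun i hi => by
    simp only [hAR, Finset.sum_add_distrib]
    rw [sum_convDiffForm_eq_zero hΩ_open hΩ_bdd hK hbL hx_inj hx_range, hRsum i hi, zero_add]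
  have hpos : ∀ J : Finset (Fin N), J.Nonempty → (∀ i ∈ J, x i ∈ Ω) →
      0 < ∑ i ∈ J, ∑ j ∈ J, femMatrix K x a_h i j := fun J hJ hJΩ => by
    simp only [hAR, Finset.sum_add_distrib]
    exact add_pos_of_pos_of_nonneg
      (sum_sum_convDiffForm_pos hd hΩ_open hΩ_bdd hΩ_reg hK hbL hb_div hx_inj hx_range hε hJ hJΩ)
      (Finset.sum_nonneg fun i _ => Finset.sum_nonneg fun j _ => hR0 i j)
  have hmax := fun hg => discrete_maximum_principle hd hΩ_reg hK hx_inj hx_range hx_int hB hA1 hA2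
    hA_off hr hrow hpos h𝒢 h𝒢_ne hU hg
  have hmin := fun hg => discrete_minimum_principle hd hΩ_reg hK hx_inj hx_range hx_int hB hA1 hA2
    hA_off hr hrow hpos h𝒢 h𝒢_ne hU hg
  have hgle : (∀ᵐ p ∂volume.restrict (simplexUnion 𝒢), g p ≤ 0) →
      ∀ i, x i ∈ interior (simplexUnion 𝒢) → femLoad Ω K x g i ≤ 0 := fun h i hi =>
    integral_nonpos_of_ae (ae_mul_hatFunction_of_ae hK h𝒢 hi (P := fun s => s ≤ 0) le_rfl
      (fun _ _ ht hs => mul_nonpos_of_nonpos_of_nonneg hs ht) h)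
  have hgge : (∀ᵐ p ∂volume.restrict (simplexUnion 𝒢), 0 ≤ g p) →
      ∀ i, x i ∈ interior (simplexUnion 𝒢) → 0 ≤ femLoad Ω K x g i := fun h i hi =>
    integral_nonneg_of_ae (ae_mul_hatFunction_of_ae hK h𝒢 hi (P := fun s => 0 ≤ s) le_rfl
      (fun _ _ ht hs => mul_nonneg hs ht) h)
  have hczero : (∀ᵐ p ∂volume.restrict (simplexUnion 𝒢), c p = 0) →
      ∀ i, x i ∈ interior (simplexUnion 𝒢) → ∫ p in Ω, c p * hatFunction K (x i) p = 0 :=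
    fun h i hi => integral_eq_zero_of_ae (ae_mul_hatFunction_of_ae hK h𝒢 hi (P := fun s => s = 0)
      rfl (fun _ _ _ hs => by rw [hs, zero_mul]) h)
  refine ⟨fun hg0 => ?_, fun hg0 => ?_, fun hcz => ⟨fun hg0 => ?_, fun hg0 => ?_⟩⟩
  · obtain ⟨m, m', hm, hm', hle, -⟩ := hmax (hgle hg0)
    -- Since the positive part is monotone, the maximum of `u_h⁺` over the frontier is the positive
    -- part of the maximum of `u_h`.
    have hmono : Monotone fun s : ℝ => max s 0 := fun _ _ h => max_le_max_right 0 h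
    have h := hmono.map_isGreatest hm'
    rw [Set.image_image] at h
    exact ⟨m, max m' 0, hm, h, hle⟩
  · obtain ⟨m, m', hm, hm', hle, -⟩ := hmin (hgge hg0)
    have hmono : Monotone fun s : ℝ => min s 0 := fun _ _ h => min_le_min_right 0 h
    have h := hmono.map_isLeast hm'
    rw [Set.image_image] at h
    exact ⟨m, min m' 0, hm, h, hle⟩
  · obtain ⟨m, m', hm, hm', -, heq⟩ := hmax (hgle hg0)
    exact ⟨m, hm, heq (hczero hcz) ▸ hm'⟩
  · obtain ⟨m, m', hm, hm', -, heq⟩ := hmin (hgge hg0)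
    exact ⟨m, hm, heq (hczero hcz) ▸ hm'⟩
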